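/- Let $n\ge 1$ and consider the system $\dot x_i = x_{i+1}+d_i(t)$, $i=1,\dots,n$, with $x_{n+1}=u$ the control input and $d_1,\dots,d_n$ bounded measurable disturbances on $[0,\infty)$. Let the reference $x_r$ be piecewise smooth on $[0,\infty)$ (finitely many pieces on each bounded interval, each piece continuously differentiable up to its end points), left-continuous, with finitely many jump times $0<t_1<\dots<t_m$ (possibly $m=0$) and no other discontinuities. Let $T,T_1,c,k_1,\dots,k_n>0$ with $T<t_{j+1}-t_j$ for all $j$. Let $\mu(t)=0$ for $t\le 0$, $\mu(t)=1$ for $t\ge T$, and $\mu(t)=\frac1C\int_0^t \exp\!\big(-\tfrac{1}{s(T-s)}\big)\,ds$ for $0<t<T$, where $C=\int_0^T \exp\!\big(-\tfrac{1}{s(T-s)}\big)\,ds$. Put $l=\frac2\pi\arctan c$; let $\frac1{h(t)}=l+(1-l)\cos^2\!\big(\frac{\pi t}{2T_1}\big)$ for $t\le T_1$ and $\frac1{h(t)}=l$ for $t>T_1$; let $\rho(t)=\tan\!\big(\frac{\pi}{2h(t)}\big)$ for $0<t\le T_1$ and $\rho(t)=c$ for $t>T_1$. Define, with $\alpha_0=x_r$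 and recursively for $i=1,\dots,n$, $$e_i=x_i-\alpha_{i-1},\qquad z_i=\begin{cases}e_i,& t\le t_1\ (\text{or } m=0),\\ \mu(t-t_j)\,e_i,& t_j<t\le t_{j+1}\ (t_{m+1}=\infty),\end{cases}$$ $$\psi_i=\tfrac{2}{\pi}h\arctan z_i,\qquad \alpha_i=-k_i\,\frac{\operatorname{artanh}\psi_i}{1-\psi_i^2},\qquad u=\alpha_n .$$ Then for every initial state $x(0)\in\mathbb R^n$ the closed loop has a (Carathéodory) solution on $[0,\infty)$, and every solution, on any time interval starting at $0$, satisfies for all $i=1,\dots,n$ (in particular for the tracking error $e_1=x_1-x_r$): 0. $|z_i(t)|<\rho(t)$ for all $t>0$; 1. if $x_r$ has no jumps, then $|e_i(t)|<\rho(t)$ for all $t>0$; 2. if $x_r$ has jumps $t_1<\dots<t_m$, then $|e_i(t)|<\rho(t)$ for $0<t\le t_1$, and for each $j$ the errors return inside the boundary within time $T$ after the jump $t_j$ and stay there until the next jump: $z_i(t)=e_i(t)$ and $|e_i(t)|<\rho(t)$ for all $t_j+T\le t\le t_{j+1}$ (for all $t\ge t_m+T$ if $j=m$). -/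

import Mathlib

open Set

noncomputable section

namespace PPC

/-- Design data of the controller for a system of order `n`: the recovery time `T` of the smooth
shift, the predefined time `T₁` and the final width `c` of the error boundary, and the gains
`k i`. All of them are positive numbers. -/
structure Design (n : ℕ) where
  T : ℝ
  T₁ : ℝ
  c : ℝ
  k : Fin n → ℝ
  T_pos : 0 < T
  T₁_pos : 0 < T₁
  c_pos : 0 < c
  k_pos : ∀ i, 0 < k i

/-- The smooth transition function: `0` for `t ≤ 0`, `1` for `t ≥ T`, and the normalized integral
of `exp (-1 / (s (T - s)))` in between. -/
def mu (T t : ℝ) : ℝ :=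
  if t ≤ 0 then 0
  else if t < T then
    (∫ s in (0 : ℝ)..t, Real.exp (-1 / (s * (T - s)))) /
      (∫ s in (0 : ℝ)..T, Real.exp (-1 / (s * (T - s))))
  else 1

/-- The factor multiplying the errors at time `t` when the reference jumps at the times in `J`:
it is `1` up to and including the first jump time, and `mu (t - τ)` where `τ` is the last jump
time with `τ < t` afterwards. -/
def factor (T : ℝ) (J : Finset ℝ) (t : ℝ) : ℝ :=
  if hJ : (J.filter (fun τ => τ < t)).Nonempty then
    mu T (t - (J.filter (fun τ => τ < t)).max' hJ)
  else 1

/-- The constant `l = (2/π) arctan c`. -/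
def ell (c : ℝ) : ℝ := 2 / Real.pi * Real.arctan c

/-- The function `1/h` of time. -/
def invH (T₁ c t : ℝ) : ℝ :=
  if t ≤ T₁ then ell c + (1 - ell c) * Real.cos (Real.pi * t / (2 * T₁)) ^ 2 else ell c

/-- The function `h` of time. -/
def hFun (T₁ c t : ℝ) : ℝ := 1 / invH T₁ c t

/-- The error boundary `ρ`, meaningful for `t > 0` (it tends to `+∞` as `t` tends to `0+`). -/
def rho (T₁ c t : ℝ) : ℝ :=
  if t ≤ T₁ then Real.tan (Real.pi / (2 * hFun T₁ c t)) else c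

/-- The transformed error `ψ = h φ`, `φ = (2/π) arctan z`. -/
def psi (T₁ c t z : ℝ) : ℝ := 2 / Real.pi * Real.arctan z * hFun T₁ c t

/-- The backstepping law `-k ϱ ς` with `ϱ = 1 / (1 - ψ²)` and `ς = artanh ψ`. -/
def law (T₁ c k t z : ℝ) : ℝ :=
  -k * (1 / (1 - psi T₁ c t z ^ 2)) * Real.artanh (psi T₁ c t z)

variable {n : ℕ}

/-- The virtual control laws at time `t` and state `x`: `α₀ = x_r(t)` and, recursively,
`αᵢ = -kᵢ ϱᵢ ςᵢ`, evaluated at the modified error `zᵢ`, which is the factor times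
`eᵢ = xᵢ - αᵢ₋₁`. The states are `x 0, …, x (n-1)`; the entry `i.castSucc` of this vector is the
law preceding the state `x i`, and the entry `i.succ` is the law following it. -/
def alpha (P : Design n) (J : Finset ℝ) (xr : ℝ → ℝ) (t : ℝ) (x : Fin n → ℝ) :
    Fin (n + 1) → ℝ :=
  Fin.induction (motive := fun _ => ℝ) (xr t)
    (fun i a => law P.T₁ P.c (P.k i) t (factor P.T J t * (x i - a)))

/-- The errors `eᵢ = xᵢ - αᵢ₋₁`; the first one is the tracking error `x₁ - x_r`. -/
def err (P : Design n) (J : Finset ℝ) (xr : ℝ → ℝ) (t : ℝ) (x : Fin n → ℝ) (i : Fin n) : ℝ :=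
  x i - alpha P J xr t x i.castSucc

/-- The modified errors `zᵢ`. -/
def modErr (P : Design n) (J : Finset ℝ) (xr : ℝ → ℝ) (t : ℝ) (x : Fin n → ℝ) (i : Fin n) : ℝ :=
  factor P.T J t * err P J xr t x i

/-- The control input `u = αₙ`. -/
def control (P : Design n) (J : Finset ℝ) (xr : ℝ → ℝ) (t : ℝ) (x : Fin n → ℝ) : ℝ :=
  alpha P J xr t x (Fin.last n)

/-- The right-hand side of the closed loop: the `i`-th component is `xᵢ₊₁ + dᵢ`, where the state
after the last one is the control input. -/
def closedLoop (P : Design n) (J : Finset ℝ) (xr : ℝ → ℝ) (d : Fin n → ℝ → ℝ)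
    (t : ℝ) (x : Fin n → ℝ) (i : Fin n) : ℝ :=
  (Fin.snoc (α := fun _ => ℝ) x (control P J xr t x) : Fin (n + 1) → ℝ) i.succ + d i t

/-- `x` is a (Carathéodory) solution of the closed loop on `[0, b]`. No bound on the errors is
part of this definition. -/
def IsSolution (P : Design n) (J : Finset ℝ) (xr : ℝ → ℝ) (d : Fin n → ℝ → ℝ)
    (b : ℝ) (x : ℝ → Fin n → ℝ) : Prop :=
  ∀ i, IntervalIntegrable (fun s => closedLoop P J xr d s (x s) i) MeasureTheory.volume 0 b ∧
    ∀ t ∈ Icc 0 b, x t i = x 0 i + ∫ s in (0 : ℝ)..t, closedLoop P J xr d s (x s) i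

/-- `f` is piecewise smooth on `[0, ∞)`: every `[0, b]` has a finite subdivision such that on each
half-open piece `(s j, s (j+1)]` the function coincides with one that is continuously
differentiable on the closed piece `[s j, s (j+1)]`. -/
def PiecewiseSmooth (f : ℝ → ℝ) : Prop :=
  ∀ b : ℝ, 0 < b → ∃ (m : ℕ) (s : ℕ → ℝ), s 0 = 0 ∧ s m = b ∧ (∀ j < m, s j < s (j + 1)) ∧
    ∀ j < m, ∃ g : ℝ → ℝ, ContDiffOn ℝ 1 g (Icc (s j) (s (j + 1))) ∧
      EqOn f g (Ioc (s j) (s (j + 1)))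

/-- `xr` is an admissible reference on `[0, ∞)` with jump times exactly `J`: it is piecewise
smooth, its discontinuities are the finitely many points of `J`, all of them positive, and
consecutive jump times are more than `T` apart. -/
structure IsReference (T : ℝ) (J : Finset ℝ) (xr : ℝ → ℝ) : Prop where
  piecewiseSmooth : PiecewiseSmooth xr
  pos : ∀ τ ∈ J, 0 < τ
  mem_iff : ∀ t, 0 ≤ t → (t ∈ J ↔ ¬ ContinuousWithinAt xr (Ici 0) t)
  gap : ∀ τ ∈ J, ∀ τ' ∈ J, τ < τ' → T < τ' - τ

end PPC

end

/-!
The modified errors are confined by a barrier argument. With `ψ = psi T₁ c t z`, the condition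
`|ψ| < 1` says exactly that `|arctan z| < (π / 2) / h`, which for `t > 0` is `|z| < ρ`; at `t = 0` it
always holds. So the task is to keep every transformed error inside `(-1, 1)`, where the law
`-k artanh ψ / (1 - ψ ^ 2)` is locally Lipschitz and blows up at the end points.

Confinement. Consider a time interval on which the factor and the reference are Lipschitz and both
time and the factor stay away from `0`. As long as all transformed errors are inside `(-1, 1)`, all
errors `eᵢ` are bounded. If `αᵢ₋₁` is Lipschitz in time, then `eᵢ` is driven by `αᵢ` up to a bounded
perturbation, consisting of the disturbance, the next error and the variation of `αᵢ₋₁`. When `ψᵢ`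
is close to `1` the law `αᵢ` is so negative that `ψᵢ` decreases, the variation of `h` and of the
factor included; likewise near `-1`. Hence `|ψᵢ| ≤ r < 1`, so `αᵢ` is bounded and Lipschitz, and the
argument passes to the next index (`exists_psi_le_step`). The margin is uniform in the solution
and in its time interval (`exists_uniform_margin`), so a first exit from `(-1, 1)` is impossible
(`inactive_of_margin`).

Regularity. The closed loop is not regular where some `ψᵢ = ±1`, so continuity statements are made
for the laws whose transformed errors are clamped to `[-ρ, ρ]` with `ρ < 1`; these are globally
Lipschitz and agree with the original ones while the clamp is inactive.

Existence. With clamped laws the equation for the state minus the integrated disturbance is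
continuous in time and globally Lipschitz, so it has solutions on whole intervals, and confinement
shows that the clamp stays inactive for `ρ` close enough to `1`.

Jumps. The half line is cut at the jumps and at the breakpoints of the reference. On each half-open
interval in between, factor and reference extend to Lipschitz functions on the closed interval
(`exists_isPiece`); after a jump the extended factor starts from `0`, so all `ψᵢ` start from `0`. Near
the left end point, where the factor or time may vanish, continuity keeps `|ψᵢ|` below `1`, and the
uniform margin takes over afterwards.
-/

namespace PPC

variable {n : ℕ}

/-! ### The scalar nonlinearities -/

/-- The nonlinearity `ϱ ς` of the control law as a function of the transformed error: it is odd and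
tends to `+∞` as its argument tends to `1`. -/
noncomputable def gain (p : ℝ) : ℝ := 1 / (1 - p ^ 2) * Real.artanh p

lemma law_eq (T₁ c k t z : ℝ) : law T₁ c k t z = -k * gain (psi T₁ c t z) := by
  unfold law gain; ring

lemma artanh_neg_eq (p : ℝ) : Real.artanh (-p) = -Real.artanh p := by
  unfold Real.artanh
  rw [← Real.log_inv, ← Real.sqrt_inv, inv_div]
  simp [sub_eq_add_neg]

lemma gain_neg (p : ℝ) : gain (-p) = -gain p := by
  simp [gain, artanh_neg_eq]

lemma psi_neg (T₁ c t z : ℝ) : psi T₁ c t (-z) = -psi T₁ c t z := by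
  simp [psi, Real.arctan_neg]

lemma exists_lipschitzOnWith_gain {r : ℝ} (hr : r < 1) :
    ∃ K, LipschitzOnWith K gain (Icc (-r) r) := by
  have h : ContDiffOn ℝ 1 gain (Icc (-r) r) := by
    have h1 : ∀ x ∈ Icc (-r) r, 0 < 1 - x := fun x hx => by linarith [hx.2]
    have h2 : ∀ x ∈ Icc (-r) r, 0 < 1 + x := fun x hx => by linarith [hx.1]
    have : ContDiffOn ℝ 1 (fun p : ℝ => 1 / (1 - p ^ 2) * (1 / 2 * Real.log ((1 + p) / (1 - p))))
        (Icc (-r) r) := by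
      refine ContDiffOn.mul (ContDiffOn.div contDiffOn_const (by fun_prop) fun x hx => ?_)
        (contDiffOn_const.mul (ContDiffOn.log (ContDiffOn.div (by fun_prop) (by fun_prop)
          fun x hx => (h1 x hx).ne') fun x hx => (div_pos (h2 x hx) (h1 x hx)).ne'))
      nlinarith [mul_pos (h1 x hx) (h2 x hx)]
    refine this.congr fun x hx => ?_
    rw [gain, Real.artanh_eq_half_log ⟨by linarith [h2 x hx], by linarith [h1 x hx]⟩]
  exact h.exists_lipschitzOnWith one_ne_zero (convex_Icc _ _) isCompact_Icc

/-- The gain exceeds any given bound close to `1`. -/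
lemma exists_le_gain (M p₀ : ℝ) (hp₀ : p₀ < 1) :
    ∃ r, p₀ ≤ r ∧ 0 < r ∧ r < 1 ∧ ∀ p, r ≤ p → p < 1 → M ≤ gain p := by
  set A := Real.artanh (1 / 2) with hA
  have hApos : 0 < A := Real.artanh_pos ⟨by norm_num, by norm_num⟩
  set N := |M| / A + 1 with hN
  have hN1 : 1 ≤ N := by rw [hN]; have : 0 ≤ |M| / A := by positivity
                         linarith
  -- for `p ≥ 1 - 1 / (2 N)` the factor `1 / (1 - p ^ 2)` is at least `N`
  have hNi : 1 / (2 * N) ≤ 1 / 2 := by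
    apply one_div_le_one_div_of_le <;> linarith
  have hNp : 0 < 1 / (2 * N) := by positivity
  refine ⟨max p₀ (1 - 1 / (2 * N)), le_max_left _ _, lt_max_of_lt_right (by linarith),
    max_lt hp₀ (by linarith), fun p hp hp1 => ?_⟩
  have hp2 : 1 - 1 / (2 * N) ≤ p := (le_max_right _ _).trans hp
  have hph : 1 / 2 ≤ p := by linarith
  have hAp : A ≤ Real.artanh p := Real.artanh_le_artanh (by norm_num) hp1 hph
  have hq : 0 < 1 - p ^ 2 := by nlinarith
  have hqN : N ≤ 1 / (1 - p ^ 2) := by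
    rw [le_div_iff₀ hq]
    have : 1 - p ^ 2 ≤ 2 * (1 / (2 * N)) := by nlinarith
    calc N * (1 - p ^ 2) ≤ N * (2 * (1 / (2 * N))) := by gcongr
      _ = 1 := by field_simp
  calc M ≤ N * A := by rw [hN, add_mul, div_mul_cancel₀ _ hApos.ne']; linarith [le_abs_self M]
    _ ≤ gain p := by unfold gain; gcongr

lemma ell_pos {c : ℝ} (hc : 0 < c) : 0 < ell c := by
  unfold ell
  have := Real.arctan_pos.2 hc
  positivity

lemma ell_lt_one (c : ℝ) : ell c < 1 := by
  unfold ell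
  have := Real.arctan_lt_pi_div_two c
  rw [div_mul_eq_mul_div, div_lt_one Real.pi_pos]
  linarith

lemma invH_eq {T₁ c : ℝ} (hT : 0 < T₁) (t : ℝ) :
    invH T₁ c t = ell c + (1 - ell c) * Real.cos (Real.pi / (2 * T₁) * min t T₁) ^ 2 := by
  unfold invH
  split_ifs with h
  · rw [min_eq_left h]; ring_nf
  · rw [min_eq_right (not_le.1 h).le, show Real.pi / (2 * T₁) * T₁ = Real.pi / 2 by field_simp]
    simp

lemma ell_le_invH {T₁ c : ℝ} (hT : 0 < T₁) (t : ℝ) : ell c ≤ invH T₁ c t := by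
  rw [invH_eq hT]
  have := ell_lt_one c
  have : 0 ≤ (1 - ell c) * Real.cos (Real.pi / (2 * T₁) * min t T₁) ^ 2 :=
    mul_nonneg (by linarith) (sq_nonneg _)
  linarith

lemma invH_pos {T₁ c : ℝ} (hT : 0 < T₁) (hc : 0 < c) (t : ℝ) : 0 < invH T₁ c t :=
  (ell_pos hc).trans_le (ell_le_invH hT t)

lemma invH_le_one {T₁ c : ℝ} (hT : 0 < T₁) (t : ℝ) : invH T₁ c t ≤ 1 := by
  rw [invH_eq hT]
  have := ell_lt_one c
  nlinarith [Real.cos_sq_le_one (Real.pi / (2 * T₁) * min t T₁)]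

lemma invH_lt_one {T₁ c : ℝ} (hT : 0 < T₁) {t : ℝ} (ht : 0 < t) : invH T₁ c t < 1 := by
  rw [invH_eq hT]
  have h1 := ell_lt_one c
  have hm : 0 < min t T₁ := lt_min ht hT
  have hs : 0 < Real.sin (Real.pi / (2 * T₁) * min t T₁) := by
    apply Real.sin_pos_of_pos_of_lt_pi
    · positivity
    · have : Real.pi / (2 * T₁) * min t T₁ ≤ Real.pi / (2 * T₁) * T₁ := by
        gcongr; exact min_le_right _ _
      have h3 : Real.pi / (2 * T₁) * T₁ = Real.pi / 2 := by field_simp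
      linarith [Real.pi_pos]
  have hc : Real.cos (Real.pi / (2 * T₁) * min t T₁) ^ 2 < 1 := by
    nlinarith [Real.sin_sq_add_cos_sq (Real.pi / (2 * T₁) * min t T₁)]
  nlinarith

lemma exists_lipschitz_invH {T₁ c : ℝ} (hT : 0 < T₁) : ∃ K, LipschitzWith K (invH T₁ c) := by
  have h1 := ell_lt_one c
  refine ⟨Real.toNNReal ((1 - ell c) * (2 * (Real.pi / (2 * T₁)))),
    LipschitzWith.of_dist_le' fun s t => ?_⟩
  rw [invH_eq hT, invH_eq hT, Real.dist_eq, Real.dist_eq]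
  set κ := Real.pi / (2 * T₁)
  have hκ : 0 < κ := by positivity
  set x := κ * min s T₁
  set y := κ * min t T₁
  have hxy : |x - y| ≤ κ * |s - t| := by
    simp only [x, y]
    rw [← mul_sub, abs_mul, abs_of_pos hκ]
    exact mul_le_mul_of_nonneg_left ((abs_min_sub_min_le_max s T₁ t T₁).trans (by simp)) hκ.le
  have hcos : |Real.cos x - Real.cos y| ≤ |x - y| := by
    have := Real.lipschitzWith_cos.dist_le_mul x y
    simpa [Real.dist_eq] using this
  have h2 : |Real.cos x + Real.cos y| ≤ 2 :=
    (abs_add_le _ _).trans (by linarith [Real.abs_cos_le_one x, Real.abs_cos_le_one y])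
  rw [show ell c + (1 - ell c) * Real.cos x ^ 2 - (ell c + (1 - ell c) * Real.cos y ^ 2) =
    (1 - ell c) * ((Real.cos x + Real.cos y) * (Real.cos x - Real.cos y)) by ring,
    abs_mul, abs_mul, abs_of_pos (by linarith : 0 < 1 - ell c)]
  calc (1 - ell c) * (|Real.cos x + Real.cos y| * |Real.cos x - Real.cos y|)
      ≤ (1 - ell c) * (2 * (κ * |s - t|)) := by
        gcongr
        exact hcos.trans hxy
    _ = _ := by ring

lemma hFun_pos {T₁ c : ℝ} (hT : 0 < T₁) (hc : 0 < c) (t : ℝ) : 0 < hFun T₁ c t :=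
  one_div_pos.2 (invH_pos hT hc t)

lemma one_le_hFun {T₁ c : ℝ} (hT : 0 < T₁) (hc : 0 < c) (t : ℝ) : 1 ≤ hFun T₁ c t :=
  one_le_one_div (invH_pos hT hc t) (invH_le_one hT t)

lemma hFun_le {T₁ c : ℝ} (hT : 0 < T₁) (hc : 0 < c) (t : ℝ) : hFun T₁ c t ≤ 1 / ell c :=
  one_div_le_one_div_of_le (ell_pos hc) (ell_le_invH hT t)

lemma exists_lipschitz_hFun {T₁ c : ℝ} (hT : 0 < T₁) (hc : 0 < c) :
    ∃ K, LipschitzWith K (hFun T₁ c) := by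
  obtain ⟨K, hK⟩ := exists_lipschitz_invH (c := c) hT
  have hl := ell_pos hc
  refine ⟨Real.toNNReal (1 / ell c * (1 / ell c) * K), LipschitzWith.of_dist_le' fun s t => ?_⟩
  have hs := invH_pos hT hc s
  have ht := invH_pos hT hc t
  have := hK.dist_le_mul s t
  rw [Real.dist_eq] at this ⊢
  have e : hFun T₁ c s - hFun T₁ c t =
      hFun T₁ c s * hFun T₁ c t * -(invH T₁ c s - invH T₁ c t) := by
    unfold hFun; field_simp; ring
  rw [e, abs_mul, abs_mul, abs_neg, abs_of_pos (hFun_pos hT hc s), abs_of_pos (hFun_pos hT hc t),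
    mul_assoc _ (K : ℝ)]
  have a1 := hFun_le hT hc s
  have a2 := hFun_le hT hc t
  have a3 := (hFun_pos hT hc t).le
  gcongr

/-- The transformed error is inside `(-1, 1)` exactly when `arctan z` is inside a band. -/
lemma abs_psi_lt_one_iff {T₁ c : ℝ} (hT : 0 < T₁) (hc : 0 < c) (t z : ℝ) :
    |psi T₁ c t z| < 1 ↔ |Real.arctan z| < Real.pi / 2 * invH T₁ c t := by
  have h := invH_pos hT hc t
  unfold psi hFun
  rw [abs_mul, abs_mul, abs_of_pos (by positivity : 0 < 2 / Real.pi),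
    abs_of_pos (by positivity : 0 < 1 / invH T₁ c t), mul_one_div, div_lt_one h,
    ← mul_lt_mul_iff_right₀ (by positivity : 0 < 2 / Real.pi) (c := Real.pi / 2 * invH T₁ c t),
    ← mul_assoc (2 / Real.pi) (Real.pi / 2), show 2 / Real.pi * (Real.pi / 2) = 1 by field_simp,
    one_mul]

lemma abs_lt_tan_of_abs_arctan_lt {z y : ℝ} (h : |Real.arctan z| < y) (hy : y < Real.pi / 2) :
    |z| < Real.tan y := by
  rw [abs_lt] at h ⊢
  have hpos : -y < y := h.1.trans h.2
  constructor
  · rw [← Real.tan_neg, ← Real.tan_arctan z]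
    exact Real.tan_lt_tan_of_lt_of_lt_pi_div_two (by linarith) (Real.arctan_lt_pi_div_two z) h.1
  · rw [← Real.tan_arctan z]
    exact Real.tan_lt_tan_of_lt_of_lt_pi_div_two (Real.neg_pi_div_two_lt_arctan z) hy h.2

lemma rho_eq {T₁ c t : ℝ} : rho T₁ c t = Real.tan (Real.pi / 2 * invH T₁ c t) := by
  unfold rho
  split_ifs with h
  · unfold hFun
    congr 1
    rw [div_mul_eq_div_div, div_div_eq_mul_div, div_one]
  · rw [invH, if_neg h, ell, ← mul_assoc, show Real.pi / 2 * (2 / Real.pi) = 1 by field_simp,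
      one_mul, Real.tan_arctan]

/-- A transformed error inside `(-1, 1)` means that the error is strictly inside the boundary. -/
lemma abs_lt_rho {T₁ c t z : ℝ} (hT : 0 < T₁) (hc : 0 < c) (ht : 0 < t)
    (h : |psi T₁ c t z| < 1) : |z| < rho T₁ c t := by
  rw [rho_eq]
  refine abs_lt_tan_of_abs_arctan_lt ((abs_psi_lt_one_iff hT hc t z).1 h) ?_
  nlinarith [Real.pi_pos, invH_lt_one (c := c) hT ht]

/-- Away from time `0` the boundary is bounded. -/
lemma exists_abs_le_of_abs_psi_lt_one {T₁ c a b : ℝ} (hT : 0 < T₁) (hc : 0 < c) (ha : 0 < a) :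
    ∃ R, 0 < R ∧ ∀ t ∈ Icc a b, ∀ z, |psi T₁ c t z| < 1 → |z| ≤ R := by
  rcases le_or_gt a b with hab | hab
  · obtain ⟨K, hK⟩ := exists_lipschitz_invH (c := c) hT
    obtain ⟨m, hm, hmax⟩ := isCompact_Icc.exists_isMaxOn (nonempty_Icc.2 hab)
      hK.continuous.continuousOn
    have hm1 := invH_lt_one (c := c) hT (ha.trans_le hm.1)
    have hm0 := invH_pos hT hc m
    have hlt : Real.pi / 2 * invH T₁ c m < Real.pi / 2 := by nlinarith [Real.pi_pos]
    refine ⟨Real.tan (Real.pi / 2 * invH T₁ c m),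
      Real.tan_pos_of_pos_of_lt_pi_div_two (by positivity) hlt, fun t ht z hz =>
      (abs_lt_tan_of_abs_arctan_lt (((abs_psi_lt_one_iff hT hc t z).1 hz).trans_le ?_) hlt).le⟩
    have : invH T₁ c t ≤ invH T₁ c m := hmax ht
    gcongr
  · exact ⟨1, one_pos, fun t ht => absurd (ht.1.trans ht.2) hab.not_ge⟩

/-- At time `0` the boundary is infinite. -/
lemma abs_psi_zero_lt_one {T₁ c : ℝ} (hT : 0 < T₁) (hc : 0 < c) (z : ℝ) :
    |psi T₁ c 0 z| < 1 := by
  rw [abs_psi_lt_one_iff hT hc, invH_eq hT, min_eq_left hT.le, mul_zero, Real.cos_zero, abs_lt]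
  have h1 := Real.arctan_lt_pi_div_two z
  have h2 := Real.neg_pi_div_two_lt_arctan z
  constructor <;> linarith

lemma psi_zero (T₁ c t : ℝ) : psi T₁ c t 0 = 0 := by simp [psi]

/-! ### The shift function -/

lemma intervalIntegrable_bump {T : ℝ} (s t : ℝ) (hs : s ∈ Icc 0 T) (ht : t ∈ Icc 0 T) :
    IntervalIntegrable (fun s => Real.exp (-1 / (s * (T - s)))) MeasureTheory.volume s t := by
  have h : MeasureTheory.IntegrableOn (fun s => Real.exp (-1 / (s * (T - s)))) (Icc 0 T) := by
    refine MeasureTheory.Measure.integrableOn_of_bounded (M := 1) (by simp)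
      (Measurable.aestronglyMeasurable (by fun_prop)) ?_
    refine (MeasureTheory.ae_restrict_iff' measurableSet_Icc).2 (.of_forall fun x hx => ?_)
    rw [Real.norm_eq_abs, Real.abs_exp, Real.exp_le_one_iff]
    exact div_nonpos_of_nonpos_of_nonneg (by norm_num) (mul_nonneg hx.1 (by linarith [hx.2]))
  exact (h.mono_set (uIcc_subset_Icc hs ht)).intervalIntegrable

lemma bump_integral_nonneg {T s t : ℝ} (hst : s ≤ t) :
    0 ≤ ∫ s in s..t, Real.exp (-1 / (s * (T - s))) :=
  intervalIntegral.integral_nonneg hst fun _ _ => (Real.exp_pos _).le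

lemma bump_integral_pos {T t : ℝ} (ht : t ∈ Ioc 0 T) :
    0 < ∫ s in (0 : ℝ)..t, Real.exp (-1 / (s * (T - s))) :=
  intervalIntegral.intervalIntegral_pos_of_pos_on
    (intervalIntegrable_bump 0 t ⟨le_rfl, ht.1.le.trans ht.2⟩ ⟨ht.1.le, ht.2⟩)
    (fun _ _ => Real.exp_pos _) ht.1

lemma bump_integral_le {T s t : ℝ} (hs : 0 ≤ s) (hst : s ≤ t) (ht : t ≤ T) :
    ∫ s in s..t, Real.exp (-1 / (s * (T - s))) ≤ t - s := by
  have h := intervalIntegral.integral_mono_on hst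
    (intervalIntegrable_bump (T := T) s t ⟨hs, hst.trans ht⟩ ⟨hs.trans hst, ht⟩)
    (intervalIntegrable_const (c := (1 : ℝ))) fun x hx => by
      rw [Real.exp_le_one_iff]
      exact div_nonpos_of_nonpos_of_nonneg (by norm_num)
        (mul_nonneg (hs.trans hx.1) (by linarith [hx.2]))
  simpa using h

/-- The shift function through the clamp of time to `[0, T]`. -/
lemma mu_eq {T : ℝ} (hT : 0 < T) (t : ℝ) :
    mu T t = (∫ s in (0 : ℝ)..(max 0 (min T t)), Real.exp (-1 / (s * (T - s)))) /
      (∫ s in (0 : ℝ)..T, Real.exp (-1 / (s * (T - s)))) := by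
  unfold mu
  split_ifs with h1 h2
  · rw [max_eq_left ((min_le_right _ _).trans h1)]; simp
  · rw [min_eq_right h2.le, max_eq_right (not_le.1 h1).le]
  · rw [min_eq_left (not_lt.1 h2), max_eq_right hT.le,
      div_self (bump_integral_pos ⟨hT, le_rfl⟩).ne']

lemma mu_of_le {T t : ℝ} (ht : t ≤ 0) : mu T t = 0 := if_pos ht

lemma mu_of_ge {T t : ℝ} (hT : 0 < T) (ht : T ≤ t) : mu T t = 1 := by
  rw [mu, if_neg (not_le.2 (hT.trans_le ht)), if_neg (not_lt.2 ht)]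

lemma clamp_mem {T : ℝ} (hT : 0 < T) (t : ℝ) : max 0 (min T t) ∈ Icc 0 T :=
  ⟨le_max_left _ _, max_le hT.le (min_le_left _ _)⟩

lemma mu_nonneg {T : ℝ} (hT : 0 < T) (t : ℝ) : 0 ≤ mu T t := by
  rw [mu_eq hT]
  exact div_nonneg (bump_integral_nonneg (le_max_left _ _)) (bump_integral_nonneg hT.le)

lemma mu_pos {T t : ℝ} (hT : 0 < T) (ht : 0 < t) : 0 < mu T t := by
  rw [mu_eq hT]
  exact div_pos (bump_integral_pos ⟨lt_max_of_lt_right (lt_min hT ht), (clamp_mem hT t).2⟩)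
    (bump_integral_pos ⟨hT, le_rfl⟩)

lemma mu_sub_eq {T : ℝ} (hT : 0 < T) (s t : ℝ) :
    mu T t - mu T s = (∫ s in (max 0 (min T s))..(max 0 (min T t)),
      Real.exp (-1 / (s * (T - s)))) / (∫ s in (0 : ℝ)..T, Real.exp (-1 / (s * (T - s)))) := by
  rw [mu_eq hT, mu_eq hT, ← sub_div, intervalIntegral.integral_interval_sub_left]
  · exact intervalIntegrable_bump _ _ ⟨le_rfl, hT.le⟩ (clamp_mem hT t)
  · exact intervalIntegrable_bump _ _ ⟨le_rfl, hT.le⟩ (clamp_mem hT s)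

lemma mu_mono {T : ℝ} (hT : 0 < T) : Monotone (mu T) := fun s t hst => by
  rw [← sub_nonneg, mu_sub_eq hT]
  exact div_nonneg (bump_integral_nonneg (by gcongr)) (bump_integral_nonneg hT.le)

lemma mu_le_one {T : ℝ} (hT : 0 < T) (t : ℝ) : mu T t ≤ 1 :=
  (mu_mono hT (le_max_left t T)).trans_eq (mu_of_ge hT (le_max_right t T))

lemma exists_lipschitz_mu {T : ℝ} (hT : 0 < T) : ∃ K, LipschitzWith K (mu T) := by
  set C := ∫ s in (0 : ℝ)..T, Real.exp (-1 / (s * (T - s))) with hC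
  have hCpos : 0 < C := bump_integral_pos ⟨hT, le_rfl⟩
  refine ⟨Real.toNNReal (1 / C), LipschitzWith.of_dist_le' fun s t => ?_⟩
  wlog hst : s ≤ t generalizing s t
  · rw [dist_comm, dist_comm s]; exact this t s (not_le.1 hst).le
  have hm := mu_mono hT hst
  rw [dist_comm, dist_comm s, Real.dist_eq, Real.dist_eq, abs_of_nonneg (sub_nonneg.2 hm),
    abs_of_nonneg (sub_nonneg.2 hst), mu_sub_eq hT, ← hC, div_eq_inv_mul, ← one_div]
  refine mul_le_mul_of_nonneg_left ?_ (by positivity)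
  refine (bump_integral_le (le_max_left _ _) (by gcongr) (clamp_mem hT t).2).trans ?_
  have h1 : min T t - min T s ≤ t - s := by
    rcases le_total T s with h | h <;> rcases le_total T t with h' | h' <;> simp [*]
    all_goals linarith
  rcases le_total 0 (min T s) with h | h <;> rcases le_total 0 (min T t) with h' | h' <;>
    simp only [max_eq_left, max_eq_right, h, h'] <;> linarith

/-! ### The barrier estimate for one error -/

lemma continuousOn_psi {T₁ c : ℝ} (hT : 0 < T₁) (hc : 0 < c) {z : ℝ → ℝ} {S : Set ℝ}
    (hz : ContinuousOn z S) : ContinuousOn (fun t => psi T₁ c t (z t)) S := by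
  obtain ⟨K, hK⟩ := exists_lipschitz_hFun hT hc
  have := hK.continuous
  unfold psi
  exact (continuousOn_const.mul (Real.continuous_arctan.comp_continuousOn hz)).mul
    this.continuousOn

lemma div_le_arctan_sub_arctan {R x y : ℝ} (hx : -R ≤ x) (hxy : x ≤ y) (hy : y ≤ R) :
    (y - x) / (1 + R ^ 2) ≤ Real.arctan y - Real.arctan x := by
  have := (convex_Icc (-R) R).mul_sub_le_image_sub_of_le_deriv
    Real.continuous_arctan.continuousOn Real.differentiable_arctan.differentiableOn
    (C := 1 / (1 + R ^ 2)) (fun u hu => by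
      rw [interior_Icc] at hu
      rw [Real.deriv_arctan]
      exact one_div_le_one_div_of_le (by positivity) (by nlinarith [hu.1, hu.2]))
    x ⟨hx, hxy.trans hy⟩ y ⟨hx.trans hxy, hy⟩ hxy
  rwa [one_div_mul_eq_div] at this

lemma abs_arctan_sub_le (x y : ℝ) : |Real.arctan y - Real.arctan x| ≤ |y - x| := by
  have : LipschitzWith 1 Real.arctan := by
    refine lipschitzWith_of_nnnorm_deriv_le Real.differentiable_arctan fun u => ?_
    rw [← NNReal.coe_le_coe, coe_nnnorm, Real.deriv_arctan, Real.norm_eq_abs,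
      abs_of_pos (by positivity), NNReal.coe_one, div_le_one (by positivity)]
    nlinarith [sq_nonneg u]
  simpa [Real.dist_eq] using this.dist_le_mul y x

lemma abs_arctan_le_two (x : ℝ) : |Real.arctan x| ≤ 2 := by
  rw [abs_le]
  have h1 := Real.arctan_lt_pi_div_two x
  have h2 := Real.neg_pi_div_two_lt_arctan x
  have := Real.pi_le_four
  constructor <;> linarith

/-- `psi` is Lipschitz in time and error jointly. -/
lemma exists_psi_lipschitz {T₁ c : ℝ} (hT : 0 < T₁) (hc : 0 < c) :
    ∃ L, 0 ≤ L ∧ ∀ s t z w, |psi T₁ c t z - psi T₁ c s w| ≤ L * (|t - s| + |z - w|) := by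
  obtain ⟨K, hK⟩ := exists_lipschitz_hFun hT hc
  have hl := ell_pos hc
  refine ⟨1 / ell c + 2 * K, by positivity, fun s t z w => ?_⟩
  have h1 := hK.dist_le_mul t s
  rw [Real.dist_eq, Real.dist_eq] at h1
  have h2 : 2 / Real.pi ≤ 1 := by
    rw [div_le_one Real.pi_pos]; linarith [Real.pi_gt_three]
  have h3 := hFun_pos hT hc t
  have h4 := hFun_le hT hc t
  have e : psi T₁ c t z - psi T₁ c s w = 2 / Real.pi *
      (hFun T₁ c t * (Real.arctan z - Real.arctan w) +
        Real.arctan w * (hFun T₁ c t - hFun T₁ c s)) := by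
    unfold psi; ring
  have h5 : |hFun T₁ c t * (Real.arctan z - Real.arctan w) +
        Real.arctan w * (hFun T₁ c t - hFun T₁ c s)| ≤
      1 / ell c * |z - w| + 2 * (K * |t - s|) := by
    refine (abs_add_le _ _).trans ?_
    rw [abs_mul, abs_mul, abs_of_pos h3]
    exact add_le_add (mul_le_mul h4 (abs_arctan_sub_le _ _) (abs_nonneg _) (by positivity))
      (mul_le_mul (abs_arctan_le_two w) h1 (abs_nonneg _) two_pos.le)
  rw [e, abs_mul, abs_of_pos (by positivity : 0 < 2 / Real.pi)]
  refine (mul_le_of_le_one_left (abs_nonneg _) h2).trans (h5.trans ?_)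
  have : 0 ≤ 1 / ell c * |t - s| + 2 * K * |z - w| := by positivity
  linarith

/-- One-sided barrier: an error `e` that is driven down at rate at least `M - V` whenever the
control law is below `-M` keeps its transformed error below some `r < 1`, and `r` depends neither
on the error nor on the length of its interval of existence. -/
lemma exists_psi_le {T₁ c k a b f₀ R V p₀ : ℝ} {F : ℝ → ℝ} {KF : NNReal} (hT : 0 < T₁) (hc : 0 < c)
    (hk : 0 < k) (hf₀ : 0 < f₀) (hF : ∀ t ∈ Icc a b, f₀ ≤ F t)
    (hFL : LipschitzOnWith KF F (Icc a b)) (hR : 0 < R) (hp₀ : p₀ < 1) :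
    ∃ r, 0 < r ∧ r < 1 ∧ ∀ t' ∈ Icc a b, ∀ e : ℝ → ℝ, ContinuousOn e (Icc a t') →
      (∀ t ∈ Icc a t', |F t * e t| ≤ R) → (∀ t ∈ Icc a t', psi T₁ c t (F t * e t) < 1) →
      psi T₁ c a (F a * e a) ≤ p₀ →
      (∀ M s t, a ≤ s → s < t → t ≤ t' → (∀ τ ∈ Ioc s t, law T₁ c k τ (F τ * e τ) ≤ -M) →
        e t - e s ≤ (V - M) * (t - s)) →
      ∀ t ∈ Icc a t', psi T₁ c t (F t * e t) ≤ r := by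
  obtain ⟨KH, hKH⟩ := exists_lipschitz_hFun hT hc
  -- the rate at which `F e` has to decrease to compensate the variation of `F` and of `hFun`
  set Q := (KF * (R / f₀) + 2 * KH * (1 + R ^ 2)) / f₀ with hQ
  have hQ0 : 0 ≤ Q := by positivity
  obtain ⟨r, hpr, hr0, hr1, hr⟩ := exists_le_gain ((V + Q) / k) p₀ hp₀
  refine ⟨r, hr0, hr1, fun t' ht' e he hFe hin hstart hdrive t₁ ht₁ => ?_⟩
  by_contra! hlt
  have hsub : Icc a t₁ ⊆ Icc a t' := Icc_subset_Icc_right ht₁.2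
  have hsubb : Icc a t' ⊆ Icc a b := Icc_subset_Icc_right ht'.2
  have hψ : ContinuousOn (fun t => psi T₁ c t (F t * e t)) (Icc a t₁) :=
    continuousOn_psi hT hc ((hFL.continuousOn.mono (hsub.trans hsubb)).mul (he.mono hsub))
  -- the last time before `t₁` at which the transformed error is at most `r`
  obtain ⟨s, ⟨hs, hsr⟩, hmax⟩ := ((isCompact_Icc (a := a) (b := t₁)).of_isClosed_subset
    (hψ.preimage_isClosed_of_isClosed isClosed_Icc isClosed_Iic) inter_subset_left).exists_isGreatest
    ⟨a, left_mem_Icc.2 ht₁.1, hstart.trans hpr⟩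
  simp only [mem_preimage, mem_Iic] at hsr
  have hst : s < t₁ := lt_of_le_of_ne hs.2 fun h => by rw [h] at hsr; exact hlt.not_ge hsr
  have habove : ∀ τ ∈ Ioc s t₁, r < psi T₁ c τ (F τ * e τ) := fun τ hτ => by
    by_contra! h
    exact hτ.1.not_ge (hmax ⟨⟨hs.1.trans hτ.1.le, hτ.2⟩, h⟩)
  have hdec := hdrive (V + Q) s t₁ hs.1 hst ht₁.2 fun τ hτ => by
    have h1 := hr _ (habove τ hτ).le (hin τ ⟨hs.1.trans hτ.1.le, hτ.2.trans ht₁.2⟩)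
    rw [div_le_iff₀ hk] at h1
    rw [law_eq]; linarith
  have hδ : 0 < t₁ - s := sub_pos.2 hst
  have hs' : s ∈ Icc a t' := hsub hs
  have hFs := hFL.dist_le_mul t₁ (hsubb ht₁) s (hsubb hs')
  rw [Real.dist_eq, Real.dist_eq, abs_of_pos hδ] at hFs
  have hes : |e s| ≤ R / f₀ := by
    rw [le_div_iff₀ hf₀]
    refine le_trans ?_ (hFe s hs')
    rw [abs_mul, mul_comm]
    gcongr
    exact (hF s (hsubb hs')).trans (le_abs_self _)
  have hz : F t₁ * e t₁ - F s * e s ≤ -(2 * KH * (1 + R ^ 2)) * (t₁ - s) := by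
    have h1 : F t₁ * (e t₁ - e s) ≤ -(f₀ * Q) * (t₁ - s) := by
      have h0 : 0 ≤ Q * (t₁ - s) := by positivity
      have h2 : F t₁ * (e t₁ - e s) ≤ F t₁ * -(Q * (t₁ - s)) :=
        mul_le_mul_of_nonneg_left (by linarith) (hf₀.le.trans (hF t₁ (hsubb ht₁)))
      nlinarith [hF t₁ (hsubb ht₁)]
    have h2 : (F t₁ - F s) * e s ≤ KF * (t₁ - s) * (R / f₀) := by
      refine (le_abs_self _).trans ?_
      rw [abs_mul]
      gcongr
    have h3 : f₀ * Q = KF * (R / f₀) + 2 * KH * (1 + R ^ 2) := by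
      rw [hQ, mul_div_cancel₀ _ hf₀.ne']
    rw [h3] at h1
    nlinarith
  have hz0 : F t₁ * e t₁ ≤ F s * e s := by
    have : 0 ≤ 2 * KH * (1 + R ^ 2) * (t₁ - s) := by positivity
    linarith
  have hatan := div_le_arctan_sub_arctan (R := R) (abs_le.1 (hFe t₁ ht₁)).1 hz0
    (abs_le.1 (hFe s hs')).2
  have hatan2 : Real.arctan (F t₁ * e t₁) - Real.arctan (F s * e s) ≤ -(2 * KH * (t₁ - s)) := by
    have : 2 * KH * (t₁ - s) ≤ (F s * e s - F t₁ * e t₁) / (1 + R ^ 2) := by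
      rw [le_div_iff₀ (by positivity)]; linarith
    linarith
  have hH := hKH.dist_le_mul t₁ s
  rw [Real.dist_eq, Real.dist_eq, abs_of_pos hδ] at hH
  have hfin : psi T₁ c t₁ (F t₁ * e t₁) ≤ psi T₁ c s (F s * e s) := by
    rw [← sub_nonpos]
    have e1 : psi T₁ c t₁ (F t₁ * e t₁) - psi T₁ c s (F s * e s) = 2 / Real.pi *
        (hFun T₁ c t₁ * (Real.arctan (F t₁ * e t₁) - Real.arctan (F s * e s)) +
          Real.arctan (F s * e s) * (hFun T₁ c t₁ - hFun T₁ c s)) := by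
      unfold psi; ring
    rw [e1]
    refine mul_nonpos_of_nonneg_of_nonpos (by positivity) ?_
    have a1 : Real.arctan (F s * e s) * (hFun T₁ c t₁ - hFun T₁ c s) ≤ 2 * (KH * (t₁ - s)) := by
      refine (le_abs_self _).trans ?_
      rw [abs_mul]
      gcongr
      exact abs_arctan_le_two _
    have a2 : 0 ≤ 2 * KH * (t₁ - s) := by positivity
    nlinarith [one_le_hFun hT hc t₁]
  linarith

/-- Two-sided barrier: the one-sided estimate for `e` and `-e`, the laws being odd in the error. -/
lemma exists_abs_psi_le {T₁ c k a b f₀ R V p₀ : ℝ} {F : ℝ → ℝ} {KF : NNReal} (hT : 0 < T₁)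
    (hc : 0 < c) (hk : 0 < k) (hf₀ : 0 < f₀) (hF : ∀ t ∈ Icc a b, f₀ ≤ F t)
    (hFL : LipschitzOnWith KF F (Icc a b)) (hR : 0 < R) (hp₀ : p₀ < 1) :
    ∃ r, 0 < r ∧ r < 1 ∧ ∀ t' ∈ Icc a b, ∀ e : ℝ → ℝ, ContinuousOn e (Icc a t') →
      (∀ t ∈ Icc a t', |F t * e t| ≤ R) → (∀ t ∈ Icc a t', |psi T₁ c t (F t * e t)| < 1) →
      |psi T₁ c a (F a * e a)| ≤ p₀ →
      (∀ M s t, a ≤ s → s < t → t ≤ t' → (∀ τ ∈ Ioc s t, law T₁ c k τ (F τ * e τ) ≤ -M) →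
        e t - e s ≤ (V - M) * (t - s)) →
      (∀ M s t, a ≤ s → s < t → t ≤ t' → (∀ τ ∈ Ioc s t, M ≤ law T₁ c k τ (F τ * e τ)) →
        (M - V) * (t - s) ≤ e t - e s) →
      ∀ t ∈ Icc a t', |psi T₁ c t (F t * e t)| ≤ r := by
  obtain ⟨r, hr0, hr1, h⟩ := exists_psi_le (V := V) hT hc hk hf₀ hF hFL hR hp₀
  refine ⟨r, hr0, hr1, fun t' ht' e he hFe hin hstart hup hdown t ht => abs_le.2 ⟨?_, ?_⟩⟩
  · have := h t' ht' (fun t => -e t) he.neg (fun t ht => by simpa using hFe t ht)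
      (fun t ht => by
        have := (abs_lt.1 (hin t ht)).1
        rw [mul_neg, psi_neg]; linarith)
      (by rw [mul_neg, psi_neg]; linarith [(abs_le.1 hstart).1])
      (fun M s t hs hst ht hM => by
        have := hdown M s t hs hst ht fun τ hτ => by
          have := hM τ hτ
          rw [mul_neg, law_eq, psi_neg, gain_neg] at this
          rw [law_eq]; linarith
        linarith) t ht
    rw [mul_neg, psi_neg] at this
    linarith
  · exact h t' ht' e he hFe (fun t ht => (abs_lt.1 (hin t ht)).2) ((le_abs_self _).trans hstart)
      hup t ht

/-! ### Recursive control laws and integral solutions -/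

/-- The backstepping recursion for arbitrary laws `φ i`, with the factor `f` and the value `r` of
the reference at the given time. -/
def chain (φ : Fin n → ℝ → ℝ) (f r : ℝ) (x : Fin n → ℝ) : Fin (n + 1) → ℝ :=
  Fin.induction (motive := fun _ => ℝ) r (fun i a => φ i (f * (x i - a)))

/-- The modified errors belonging to `chain`. -/
def chainErr (φ : Fin n → ℝ → ℝ) (f r : ℝ) (x : Fin n → ℝ) (i : Fin n) : ℝ :=
  f * (x i - chain φ f r x i.castSucc)

@[simp] lemma chain_zero (φ : Fin n → ℝ → ℝ) (f r : ℝ) (x : Fin n → ℝ) : chain φ f r x 0 = r := rfl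

lemma chain_succ (φ : Fin n → ℝ → ℝ) (f r : ℝ) (x : Fin n → ℝ) (i : Fin n) :
    chain φ f r x i.succ = φ i (chainErr φ f r x i) :=
  Fin.induction_succ ..

/-- Laws that agree at the errors they meet give the same recursion. -/
lemma chain_congr {φ φ' : Fin n → ℝ → ℝ} {f r : ℝ} {x : Fin n → ℝ}
    (h : ∀ i, φ i (chainErr φ f r x i) = φ' i (chainErr φ f r x i)) :
    chain φ f r x = chain φ' f r x := by
  funext j
  induction j using Fin.induction with
  | zero => rfl
  | succ i ih => rw [chain_succ, chain_succ, h, chainErr, chainErr, ih]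

/-- The laws of the design, indexed by time. -/
noncomputable def designLaw (P : Design n) (t : ℝ) (i : Fin n) (z : ℝ) : ℝ :=
  law P.T₁ P.c (P.k i) t z

/-- The state vector followed by the control input. -/
def withInput (φ : Fin n → ℝ → ℝ) (f r : ℝ) (x : Fin n → ℝ) : Fin (n + 1) → ℝ :=
  Fin.snoc (α := fun _ => ℝ) x (chain φ f r x (Fin.last n))

/-- The closed loop for arbitrary laws `φ`, factor `F` and reference `g`. -/
def loop (φ : ℝ → Fin n → ℝ → ℝ) (F g : ℝ → ℝ) (d : Fin n → ℝ → ℝ) (t : ℝ) (x : Fin n → ℝ)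
    (i : Fin n) : ℝ :=
  withInput (φ t) (F t) (g t) x i.succ + d i t

/-- All transformed errors are inside `(-1, 1)`. -/
def Inside (P : Design n) (f r t : ℝ) (x : Fin n → ℝ) : Prop :=
  ∀ i, |psi P.T₁ P.c t (chainErr (designLaw P t) f r x i)| < 1

/-- `x` is an integral solution of `x' = G t x` on `[a, b]`. -/
def SolvesOn (G : ℝ → (Fin n → ℝ) → Fin n → ℝ) (a b : ℝ) (x : ℝ → Fin n → ℝ) : Prop :=
  ∀ i, IntervalIntegrable (fun s => G s (x s) i) MeasureTheory.volume a b ∧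
    ∀ t ∈ Icc a b, x t i = x a i + ∫ s in a..t, G s (x s) i

namespace SolvesOn

variable {G G' : ℝ → (Fin n → ℝ) → Fin n → ℝ} {a b c : ℝ} {x y : ℝ → Fin n → ℝ}

lemma intervalIntegrable (h : SolvesOn G a b x) (i : Fin n) {s t : ℝ} (hs : s ∈ Icc a b)
    (ht : t ∈ Icc a b) :
    IntervalIntegrable (fun s => G s (x s) i) MeasureTheory.volume s t :=
  (h i).1.mono_set ((uIcc_subset_Icc hs ht).trans Icc_subset_uIcc)

lemma sub_eq (h : SolvesOn G a b x) (i : Fin n) {s t : ℝ} (hs : s ∈ Icc a b) (ht : t ∈ Icc a b) :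
    x t i - x s i = ∫ τ in s..t, G τ (x τ) i := by
  have ha : a ∈ Icc a b := ⟨le_rfl, hs.1.trans hs.2⟩
  rw [(h i).2 t ht, (h i).2 s hs, add_sub_add_left_eq_sub,
    intervalIntegral.integral_interval_sub_left (h.intervalIntegrable i ha ht)
      (h.intervalIntegrable i ha hs)]

lemma mono (h : SolvesOn G a b x) {a' b' : ℝ} (ha : a ≤ a') (hab : a' ≤ b') (hb : b' ≤ b) :
    SolvesOn G a' b' x := fun i => by
  have ha' : a' ∈ Icc a b := ⟨ha, hab.trans hb⟩
  refine ⟨h.intervalIntegrable i ha' ⟨ha.trans hab, hb⟩, fun t ht => ?_⟩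
  rw [← h.sub_eq i ha' ⟨ha.trans ht.1, ht.2.trans hb⟩]
  ring

lemma continuousOn (h : SolvesOn G a b x) (hab : a ≤ b) : ContinuousOn x (Icc a b) := by
  refine continuousOn_pi.2 fun i => ?_
  have := intervalIntegral.continuousOn_primitive_interval (μ := MeasureTheory.volume)
    (a := a) (b := b) (f := fun s => G s (x s) i) (by
      have := (intervalIntegrable_iff' (μ := MeasureTheory.volume)).1 (h i).1
      exact this)
  rw [uIcc_of_le hab] at this
  exact (continuousOn_const.add this).congr fun t ht => (h i).2 t ht

/-- The field may be changed at the left end point and away from the solution. -/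
lemma congr (h : SolvesOn G a b x) (hab : a ≤ b)
    (hG : ∀ t ∈ Ioc a b, G t (x t) = G' t (x t)) : SolvesOn G' a b x := fun i => by
  refine ⟨(h i).1.congr fun t ht => ?_, fun t ht => ?_⟩
  · rw [uIoc_of_le hab] at ht
    simp only [hG t ht]
  · rw [(h i).2 t ht]
    congr 1
    refine intervalIntegral.integral_congr_ae (.of_forall fun τ hτ => ?_)
    rw [uIoc_of_le ht.1] at hτ
    rw [hG τ ⟨hτ.1, hτ.2.trans ht.2⟩]

lemma congr_left (h : SolvesOn G a b x) (hxy : EqOn x y (Icc a b)) (hab : a ≤ b) :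
    SolvesOn G a b y := fun i => by
  refine ⟨(h i).1.congr fun t ht => ?_, fun t ht => ?_⟩
  · rw [uIoc_of_le hab] at ht
    simp only [hxy ⟨ht.1.le, ht.2⟩]
  · rw [← hxy ht, ← hxy ⟨le_rfl, hab⟩, (h i).2 t ht]
    congr 1
    refine intervalIntegral.integral_congr fun τ hτ => ?_
    rw [uIcc_of_le ht.1] at hτ
    simp only [hxy ⟨hτ.1, hτ.2.trans ht.2⟩]

/-- Solutions on adjacent intervals form a solution on the union. -/
lemma trans (h : SolvesOn G a b x) (h' : SolvesOn G b c x) (hab : a ≤ b) (hbc : b ≤ c) :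
    SolvesOn G a c x := fun i => by
  refine ⟨(h i).1.trans (h' i).1, fun t ht => ?_⟩
  rcases le_total t b with htb | htb
  · exact (h i).2 t ⟨ht.1, htb⟩
  · rw [(h' i).2 t ⟨htb, ht.2⟩, (h i).2 b ⟨hab, le_rfl⟩, add_assoc,
      intervalIntegral.integral_add_adjacent_intervals (h i).1
        (h'.intervalIntegrable i ⟨le_rfl, hbc⟩ ⟨htb, ht.2⟩)]

/-- Concatenation of solutions. -/
lemma glue (h : SolvesOn G a b x) (h' : SolvesOn G b c y) (hab : a ≤ b) (hbc : b ≤ c)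
    (hb : x b = y b) : SolvesOn G a c (fun t => if t ≤ b then x t else y t) := by
  refine SolvesOn.trans (b := b) (h.congr_left (fun t ht => by simp [ht.2]) hab)
    (h'.congr_left (fun t ht => ?_) hbc) hab hbc
  rcases ht.1.eq_or_lt with rfl | h1
  · simp [hb]
  · simp [h1.not_ge]

end SolvesOn

/-! ### The barrier estimate for the closed loop -/

lemma abs_withInput_sub_chain_le {φ : Fin n → ℝ → ℝ} {f r B : ℝ} {x : Fin n → ℝ} (hB : 0 ≤ B)
    (h : ∀ i, |x i - chain φ f r x i.castSucc| ≤ B) (j : Fin (n + 1)) :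
    |withInput φ f r x j - chain φ f r x j| ≤ B := by
  induction j using Fin.lastCases with
  | last => simpa [withInput] using hB
  | cast i => simpa [withInput] using h i

/-- A solution on `[a, t']` that starts at `xa` and is inside the boundary throughout. -/
structure Confined (P : Design n) (F g : ℝ → ℝ) (d : Fin n → ℝ → ℝ) (a : ℝ) (xa : Fin n → ℝ)
    (t' : ℝ) (x : ℝ → Fin n → ℝ) : Prop where
  start : x a = xa
  solves : SolvesOn (loop (designLaw P) F g d) a t' x
  inside : ∀ t ∈ Icc a t', Inside P (F t) (g t) t (x t)

/-- One step of the backstepping recursion. If the law preceding the state `x i` is Lipschitz in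
time, uniformly over all confined solutions, then the transformed error of index `i` keeps a uniform
margin from `±1`, and hence the law following `x i` is uniformly Lipschitz as well. The next state
differs from that law by the next error only, which is bounded because the solution is confined. -/
lemma exists_psi_le_step (P : Design n) {F g : ℝ → ℝ} {d : Fin n → ℝ → ℝ} {a b f₀ D : ℝ}
    {KF : NNReal} {xa : Fin n → ℝ} (ha : 0 < a) (hf₀ : 0 < f₀) (hF : ∀ t ∈ Icc a b, f₀ ≤ F t)
    (hF1 : ∀ t ∈ Icc a b, F t ≤ 1) (hFL : LipschitzOnWith KF F (Icc a b))
    (hd : ∀ i t, 0 ≤ t → |d i t| ≤ D) (hxa : Inside P (F a) (g a) a xa) (i : Fin n) {C : ℝ}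
    (hC : ∀ t' ∈ Icc a b, ∀ x, Confined P F g d a xa t' x →
      ∀ s t, a ≤ s → s ≤ t → t ≤ t' →
        |chain (designLaw P t) (F t) (g t) (x t) i.castSucc -
          chain (designLaw P s) (F s) (g s) (x s) i.castSucc| ≤ C * (t - s)) :
    (∃ r, 0 < r ∧ r < 1 ∧ ∀ t' ∈ Icc a b, ∀ x, Confined P F g d a xa t' x → ∀ t ∈ Icc a t',
      |psi P.T₁ P.c t (chainErr (designLaw P t) (F t) (g t) (x t) i)| ≤ r) ∧
    ∃ C', ∀ t' ∈ Icc a b, ∀ x, Confined P F g d a xa t' x →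
      ∀ s t, a ≤ s → s ≤ t → t ≤ t' →
        |chain (designLaw P t) (F t) (g t) (x t) i.succ -
          chain (designLaw P s) (F s) (g s) (x s) i.succ| ≤ C' * (t - s) := by
  obtain ⟨R, hR, hRz⟩ := exists_abs_le_of_abs_psi_lt_one (b := b) P.T₁_pos P.c_pos ha
  set B := R / f₀ with hB
  have hB0 : 0 ≤ B := by positivity
  have hk := P.k_pos i
  have herr : ∀ t' ∈ Icc a b, ∀ x, Confined P F g d a xa t' x → ∀ t ∈ Icc a t', ∀ j,
      |x t j - chain (designLaw P t) (F t) (g t) (x t) j.castSucc| ≤ B := by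
    intro t' ht' x hx t ht j
    have ht2 : t ∈ Icc a b := ⟨ht.1, ht.2.trans ht'.2⟩
    have h1 := hRz t ht2 _ (hx.inside t ht j)
    rw [chainErr, abs_mul] at h1
    rw [hB, le_div_iff₀ hf₀, mul_comm]
    refine le_trans ?_ h1
    gcongr
    exact (hF t ht2).trans (le_abs_self _)
  have hnext : ∀ t' ∈ Icc a b, ∀ x, Confined P F g d a xa t' x → ∀ t ∈ Icc a t',
      |loop (designLaw P) F g d t (x t) i -
        law P.T₁ P.c (P.k i) t (chainErr (designLaw P t) (F t) (g t) (x t) i)| ≤ B + D := by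
    intro t' ht' x hx t ht
    have h1 := abs_withInput_sub_chain_le hB0 (herr t' ht' x hx t ht) i.succ
    rw [chain_succ] at h1
    rw [loop, add_sub_right_comm]
    exact (abs_add_le _ _).trans (add_le_add h1 (hd i t (ha.le.trans ht.1)))
  obtain ⟨r, hr0, hr1, hr⟩ := exists_abs_psi_le (V := B + D + C) P.T₁_pos P.c_pos hk hf₀ hF hFL hR
    (hxa i)
  have hrx : ∀ t' ∈ Icc a b, ∀ x, Confined P F g d a xa t' x → ∀ t ∈ Icc a t',
      |psi P.T₁ P.c t (chainErr (designLaw P t) (F t) (g t) (x t) i)| ≤ r := by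
    intro t' ht' x hx
    have hxc := continuousOn_pi.1 (hx.solves.continuousOn ht'.1) i
    have hαc : ContinuousOn (fun t => chain (designLaw P t) (F t) (g t) (x t) i.castSucc)
        (Icc a t') := by
      have : LipschitzOnWith (Real.toNNReal C)
          (fun t => chain (designLaw P t) (F t) (g t) (x t) i.castSucc) (Icc a t') := by
        refine LipschitzOnWith.of_dist_le' fun s hs t ht => ?_
        rcases le_total s t with hst | hst
        · rw [dist_comm, dist_comm s, Real.dist_eq, Real.dist_eq, abs_of_nonneg (sub_nonneg.2 hst)]
          exact hC t' ht' x hx s t hs.1 hst ht.2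
        · rw [Real.dist_eq, Real.dist_eq, abs_of_nonneg (sub_nonneg.2 hst)]
          exact hC t' ht' x hx t s ht.1 hst hs.2
      exact this.continuousOn
    refine hr t' ht' (fun t => x t i - chain (designLaw P t) (F t) (g t) (x t) i.castSucc)
      (hxc.sub hαc) (fun t ht => hRz t ⟨ht.1, ht.2.trans ht'.2⟩ _ (hx.inside t ht i))
      (fun t ht => hx.inside t ht i) (by simp only [hx.start]; exact le_rfl) ?_ ?_
    · intro M s t hs hst ht hM
      have hs' : s ∈ Icc a t' := ⟨hs, hst.le.trans ht⟩
      have htm : t ∈ Icc a t' := ⟨hs.trans hst.le, ht⟩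
      have h1 := intervalIntegral.integral_mono_on_of_le_Ioo hst.le
        (hx.solves.intervalIntegrable i hs' htm)
        (intervalIntegrable_const (c := -M + (B + D))) fun τ hτ => by
          have h2 := (abs_le.1 (hnext t' ht' x hx τ ⟨hs.trans hτ.1.le, hτ.2.le.trans ht⟩)).2
          have h3 := hM τ ⟨hτ.1, hτ.2.le⟩
          change law P.T₁ P.c (P.k i) τ (chainErr (designLaw P τ) (F τ) (g τ) (x τ) i) ≤ _ at h3
          linarith
      rw [← hx.solves.sub_eq i hs' htm, intervalIntegral.integral_const, smul_eq_mul] at h1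
      have h4 := (abs_le.1 (hC t' ht' x hx s t hs hst.le ht)).1
      nlinarith
    · intro M s t hs hst ht hM
      have hs' : s ∈ Icc a t' := ⟨hs, hst.le.trans ht⟩
      have htm : t ∈ Icc a t' := ⟨hs.trans hst.le, ht⟩
      have h1 := intervalIntegral.integral_mono_on_of_le_Ioo hst.le
        (intervalIntegrable_const (c := M - (B + D)))
        (hx.solves.intervalIntegrable i hs' htm) fun τ hτ => by
          have h2 := (abs_le.1 (hnext t' ht' x hx τ ⟨hs.trans hτ.1.le, hτ.2.le.trans ht⟩)).1
          have h3 := hM τ ⟨hτ.1, hτ.2.le⟩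
          change _ ≤ law P.T₁ P.c (P.k i) τ (chainErr (designLaw P τ) (F τ) (g τ) (x τ) i) at h3
          linarith
      rw [← hx.solves.sub_eq i hs' htm, intervalIntegral.integral_const, smul_eq_mul] at h1
      have h4 := (abs_le.1 (hC t' ht' x hx s t hs hst.le ht)).2
      nlinarith
  refine ⟨⟨r, hr0, hr1, hrx⟩, ?_⟩
  obtain ⟨K, hK⟩ := exists_lipschitzOnWith_gain hr1
  obtain ⟨L, hL0, hL⟩ := exists_psi_lipschitz P.T₁_pos P.c_pos
  -- velocity bound for `x i`, and Lipschitz constants of the modified error and of the next law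
  set W := P.k i * K + (B + D) with hW
  set L₁ := W + C + KF * B with hL₁
  refine ⟨P.k i * (K * (L * (1 + L₁))), fun t' ht' x hx s t hs hst ht => ?_⟩
  have hs' : s ∈ Icc a t' := ⟨hs, hst.trans ht⟩
  have htm : t ∈ Icc a t' := ⟨hs.trans hst, ht⟩
  have hsub : Icc a t' ⊆ Icc a b := Icc_subset_Icc_right ht'.2
  have hmem : ∀ τ ∈ Icc a t', psi P.T₁ P.c τ (chainErr (designLaw P τ) (F τ) (g τ) (x τ) i) ∈
      Icc (-r) r := fun τ hτ => abs_le.1 (hrx t' ht' x hx τ hτ)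
  have hlaw : ∀ τ ∈ Icc a t',
      |law P.T₁ P.c (P.k i) τ (chainErr (designLaw P τ) (F τ) (g τ) (x τ) i)| ≤ P.k i * K := by
    intro τ hτ
    have h1 := hK.dist_le_mul _ (hmem τ hτ) 0 ⟨by linarith, hr0.le⟩
    rw [Real.dist_eq, Real.dist_eq, show gain 0 = 0 by simp [gain], sub_zero, sub_zero] at h1
    rw [law_eq, abs_mul, abs_neg, abs_of_pos hk]
    gcongr
    exact h1.trans (mul_le_of_le_one_right K.2 ((hrx t' ht' x hx τ hτ).trans hr1.le))
  have hx1 : |x t i - x s i| ≤ W * (t - s) := by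
    rw [hx.solves.sub_eq i hs' htm]
    have := intervalIntegral.norm_integral_le_of_norm_le_const
      (f := fun τ => loop (designLaw P) F g d τ (x τ) i) (a := s) (b := t) (C := W) fun τ hτ => by
        rw [uIoc_of_le hst] at hτ
        have hτ' : τ ∈ Icc a t' := ⟨hs.trans hτ.1.le, hτ.2.trans ht⟩
        have h1 := hnext t' ht' x hx τ hτ'
        have h2 := hlaw τ hτ'
        rw [Real.norm_eq_abs]
        rw [abs_le] at h1 h2 ⊢
        constructor <;> linarith
    rwa [Real.norm_eq_abs, abs_of_nonneg (sub_nonneg.2 hst)] at this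
  have hz : |chainErr (designLaw P t) (F t) (g t) (x t) i -
      chainErr (designLaw P s) (F s) (g s) (x s) i| ≤ L₁ * (t - s) := by
    have h1 := hC t' ht' x hx s t hs hst ht
    have h2 := herr t' ht' x hx s hs' i
    have h3 := hFL.dist_le_mul t (hsub htm) s (hsub hs')
    rw [Real.dist_eq, Real.dist_eq, abs_of_nonneg (sub_nonneg.2 hst)] at h3
    unfold chainErr
    generalize chain (designLaw P t) (F t) (g t) (x t) i.castSucc = αt at *
    generalize chain (designLaw P s) (F s) (g s) (x s) i.castSucc = αs at *
    rw [show F t * (x t i - αt) - F s * (x s i - αs) =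
      F t * ((x t i - x s i) - (αt - αs)) + (F t - F s) * (x s i - αs) by ring]
    have h4 : |F t * ((x t i - x s i) - (αt - αs))| ≤ (W + C) * (t - s) := by
      rw [abs_mul, abs_of_pos (hf₀.trans_le (hF t (hsub htm)))]
      refine (mul_le_of_le_one_left (abs_nonneg _) (hF1 t (hsub htm))).trans ?_
      refine (abs_sub _ _).trans ?_
      linarith
    have h5 : |(F t - F s) * (x s i - αs)| ≤ KF * (t - s) * B := by
      rw [abs_mul]; exact mul_le_mul h3 h2 (abs_nonneg _) ((abs_nonneg _).trans h3)
    refine (abs_add_le _ _).trans ((add_le_add h4 h5).trans_eq ?_)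
    rw [hL₁]; ring
  rw [chain_succ, chain_succ, designLaw, designLaw, law_eq, law_eq, ← mul_sub, abs_mul, abs_neg,
    abs_of_pos hk, mul_assoc]
  have h1 := hK.dist_le_mul _ (hmem t htm) _ (hmem s hs')
  rw [Real.dist_eq, Real.dist_eq] at h1
  refine mul_le_mul_of_nonneg_left (h1.trans ?_) hk.le
  rw [mul_assoc]
  refine mul_le_mul_of_nonneg_left ((hL s t _ _).trans ?_) K.2
  rw [mul_assoc]
  refine mul_le_mul_of_nonneg_left ?_ hL0
  rw [abs_of_nonneg (sub_nonneg.2 hst)]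
  linarith

/-- On a time interval where the factor and the reference are Lipschitz and the factor and time are
bounded away from `0`, solutions inside the boundary stay uniformly away from it; the margin does
not depend on the length of their interval of existence. -/
lemma exists_uniform_margin (P : Design n) {F g : ℝ → ℝ} {d : Fin n → ℝ → ℝ} {a b f₀ D : ℝ}
    {KF Kg : NNReal} {xa : Fin n → ℝ} (ha : 0 < a) (hf₀ : 0 < f₀) (hF : ∀ t ∈ Icc a b, f₀ ≤ F t)
    (hF1 : ∀ t ∈ Icc a b, F t ≤ 1) (hFL : LipschitzOnWith KF F (Icc a b))
    (hgL : LipschitzOnWith Kg g (Icc a b))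
    (hd : ∀ i t, 0 ≤ t → |d i t| ≤ D) (hxa : Inside P (F a) (g a) a xa) :
    ∃ r, 0 < r ∧ r < 1 ∧ ∀ t' ∈ Icc a b, ∀ x, Confined P F g d a xa t' x → ∀ t ∈ Icc a t', ∀ i,
      |psi P.T₁ P.c t (chainErr (designLaw P t) (F t) (g t) (x t) i)| ≤ r := by
  have hC : ∀ j : Fin (n + 1), ∃ C, ∀ t' ∈ Icc a b, ∀ x, Confined P F g d a xa t' x →
      ∀ s t, a ≤ s → s ≤ t → t ≤ t' →
        |chain (designLaw P t) (F t) (g t) (x t) j -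
          chain (designLaw P s) (F s) (g s) (x s) j| ≤ C * (t - s) := by
    intro j
    induction j using Fin.induction with
    | zero =>
      refine ⟨Kg, fun t' ht' x _ s t hs hst ht => ?_⟩
      have := hgL.dist_le_mul t ⟨hs.trans hst, ht.trans ht'.2⟩ s ⟨hs, hst.trans (ht.trans ht'.2)⟩
      rwa [Real.dist_eq, Real.dist_eq, abs_of_nonneg (sub_nonneg.2 hst)] at this
    | succ i ih =>
      obtain ⟨C, hC⟩ := ih
      exact (exists_psi_le_step P ha hf₀ hF hF1 hFL hd hxa i hC).2
  have hr : ∀ i : Fin n, ∃ r, 0 < r ∧ r < 1 ∧ ∀ t' ∈ Icc a b, ∀ x, Confined P F g d a xa t' x →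
      ∀ t ∈ Icc a t',
        |psi P.T₁ P.c t (chainErr (designLaw P t) (F t) (g t) (x t) i)| ≤ r := by
    intro i
    obtain ⟨C, hC⟩ := hC i.castSucc
    exact (exists_psi_le_step P ha hf₀ hF hF1 hFL hd hxa i hC).1
  choose r hr0 hr1 hr using hr
  obtain ⟨q, hq⟩ : ∃ q, (0 < q ∧ q < 1) ∧ ∀ i, r i ≤ q := by
    rcases isEmpty_or_nonempty (Fin n) with he | hne
    · exact ⟨1 / 2, by norm_num, fun i => he.elim i⟩
    · obtain ⟨m, hm⟩ := Finite.exists_max r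
      exact ⟨r m, ⟨hr0 m, hr1 m⟩, hm⟩
  exact ⟨q, hq.1.1, hq.1.2, fun t' ht' x hx t ht i => (hr i t' ht' x hx t ht).trans (hq.2 i)⟩

/-! ### Global solutions for globally Lipschitz fields -/

/-- Coordinatewise clamp to the box `[-M, M]ⁿ`. -/
def boxClamp (M : ℝ) (y : Fin n → ℝ) (i : Fin n) : ℝ := max (-M) (min M (y i))

lemma abs_clamp_le_abs {M : ℝ} (hM : 0 ≤ M) (u : ℝ) : |max (-M) (min M u)| ≤ |u| := by
  rcases max_choice (-M) (min M u) with h | h <;> rcases min_choice M u with h' | h' <;>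
    rw [abs_le] <;> constructor <;> grind

lemma abs_clamp_le {M : ℝ} (hM : 0 ≤ M) (u : ℝ) : |max (-M) (min M u)| ≤ M :=
  abs_le.2 ⟨le_max_left _ _, max_le (by linarith) (min_le_left _ _)⟩

lemma clamp_eq {M u : ℝ} (h : |u| ≤ M) : max (-M) (min M u) = u := by
  rw [abs_le] at h
  rw [min_eq_right h.2, max_eq_right h.1]

lemma abs_clamp_sub_le (M u v : ℝ) : |max (-M) (min M u) - max (-M) (min M v)| ≤ |u - v| := by
  refine (abs_max_sub_max_le_max (-M) (min M u) (-M) (min M v)).trans ?_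
  rw [sub_self, abs_zero, max_eq_right (abs_nonneg _)]
  exact (abs_min_sub_min_le_max M u M v).trans (by simp)

lemma lipschitzWith_boxClamp (M : ℝ) : LipschitzWith 1 (boxClamp M : (Fin n → ℝ) → Fin n → ℝ) :=
  LipschitzWith.of_dist_le_mul fun x y => by
    rw [NNReal.coe_one, one_mul]
    exact (dist_pi_le_iff dist_nonneg).2 fun i => by
      refine le_trans ?_ (dist_le_pi_dist x y i)
      exact abs_clamp_sub_le M (x i) (y i)

lemma norm_boxClamp_le_norm {M : ℝ} (hM : 0 ≤ M) (y : Fin n → ℝ) : ‖boxClamp M y‖ ≤ ‖y‖ :=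
  (pi_norm_le_iff_of_nonneg (norm_nonneg _)).2 fun i =>
    (abs_clamp_le_abs hM (y i)).trans (norm_le_pi_norm y i)

lemma norm_boxClamp_le {M : ℝ} (hM : 0 ≤ M) (y : Fin n → ℝ) : ‖boxClamp M y‖ ≤ M :=
  (pi_norm_le_iff_of_nonneg hM).2 fun i => abs_clamp_le hM (y i)

lemma boxClamp_eq {M : ℝ} {y : Fin n → ℝ} (h : ‖y‖ ≤ M) : boxClamp M y = y :=
  funext fun i => clamp_eq ((norm_le_pi_norm y i).trans h)

/-- Existence on a whole interval for a field that is continuous in time and globally Lipschitz.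
The field is made bounded by clamping its argument, and Grönwall's inequality shows that the
solution never meets the clamp. -/
lemma exists_hasDerivWithinAt_of_lipschitz {V : ℝ → (Fin n → ℝ) → Fin n → ℝ} {a b : ℝ}
    (hab : a ≤ b) {K : NNReal} (hL : ∀ t ∈ Icc a b, LipschitzWith K (V t))
    (hcont : ∀ y, ContinuousOn (fun t => V t y) (Icc a b)) (y₀ : Fin n → ℝ) :
    ∃ y : ℝ → Fin n → ℝ, y a = y₀ ∧
      ∀ t ∈ Icc a b, HasDerivWithinAt y (V t (y t)) (Icc a b) t := by
  obtain ⟨C₀, hC₀⟩ := isCompact_Icc.exists_bound_of_continuousOn (hcont 0)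
  have hC₀0 : 0 ≤ C₀ := (norm_nonneg _).trans (hC₀ a ⟨le_rfl, hab⟩)
  have hgrow : ∀ t ∈ Icc a b, ∀ y, ‖V t y‖ ≤ K * ‖y‖ + C₀ := fun t ht y => by
    have h1 := (hL t ht).dist_le_mul y 0
    rw [dist_eq_norm, dist_zero_right] at h1
    calc ‖V t y‖ = ‖(V t y - V t 0) + V t 0‖ := by rw [sub_add_cancel]
      _ ≤ _ := (norm_add_le _ _).trans (add_le_add h1 (hC₀ t ht))
  set M := gronwallBound ‖y₀‖ K C₀ (b - a) with hM
  have hMmono := gronwallBound_mono (norm_nonneg y₀) hC₀0 K.2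
  have hM0 : 0 ≤ M := by
    have h1 : gronwallBound ‖y₀‖ K C₀ 0 ≤ M := hMmono (sub_nonneg.2 hab)
    rw [gronwallBound_x0] at h1
    exact (norm_nonneg _).trans h1
  have hPL : IsPicardLindelof (fun t y => V t (boxClamp M y)) (tmin := a) (tmax := b)
      ⟨a, le_rfl, hab⟩ y₀ (Real.toNNReal ((K * M + C₀) * (b - a))) 0
      (Real.toNNReal (K * M + C₀)) K := by
    refine ⟨fun t ht => ?_, fun y _ => hcont _, fun t ht y _ => ?_, ?_⟩
    · have := (hL t ht).comp (lipschitzWith_boxClamp (n := n) M)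
      rw [mul_one] at this
      exact this.lipschitzOnWith
    · rw [Real.coe_toNNReal _ (by positivity)]
      refine (hgrow t ht _).trans ?_
      gcongr
      exact norm_boxClamp_le hM0 y
    · rw [Real.coe_toNNReal _ (by positivity), Real.coe_toNNReal _
        (mul_nonneg (by positivity) (sub_nonneg.2 hab))]
      simp [hab]
  obtain ⟨y, hya, hy⟩ := hPL.exists_eq_forall_mem_Icc_hasDerivWithinAt₀
  refine ⟨y, hya, fun t ht => ?_⟩
  have hbound := norm_le_gronwallBound_of_norm_deriv_right_le (δ := ‖y₀‖) (K := K) (ε := C₀)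
    (f' := fun t => V t (boxClamp M (y t)))
    (fun t ht => (hy t ht).continuousWithinAt)
    (fun t ht => (hy t ⟨ht.1, ht.2.le⟩).mono_of_mem_nhdsWithin (Icc_mem_nhdsGE_of_mem ht))
    (by simp only at hya; rw [hya]) (fun t ht => by
      refine (hgrow t ⟨ht.1, ht.2.le⟩ _).trans ?_
      gcongr
      exact norm_boxClamp_le_norm hM0 _) t ht
  have hM' : ‖y t‖ ≤ M := hbound.trans (hMmono (by linarith [ht.2]))
  simpa only [boxClamp_eq hM'] using hy t ht

/-! ### Truncated control laws -/

/-- The control laws with the transformed errors clamped to `[-r, r]`. For `r < 1` they are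
globally Lipschitz, and they agree with the control laws while the transformed errors are at most
`r` in absolute value. -/
noncomputable def truncLaw (P : Design n) (r t : ℝ) (i : Fin n) (z : ℝ) : ℝ :=
  -P.k i * gain (max (-r) (min r (psi P.T₁ P.c t z)))

lemma truncLaw_eq {P : Design n} {r t : ℝ} {i : Fin n} {z : ℝ} (h : |psi P.T₁ P.c t z| ≤ r) :
    truncLaw P r t i z = designLaw P t i z := by
  rw [truncLaw, clamp_eq h, designLaw, law_eq]

lemma exists_truncLaw_lipschitz (P : Design n) {r : ℝ} (hr0 : 0 ≤ r) (hr1 : r < 1) :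
    ∃ L, 0 ≤ L ∧ ∀ i s t z w,
      |truncLaw P r t i z - truncLaw P r s i w| ≤ L * (|t - s| + |z - w|) := by
  obtain ⟨K, hK⟩ := exists_lipschitzOnWith_gain hr1
  obtain ⟨L, hL0, hL⟩ := exists_psi_lipschitz P.T₁_pos P.c_pos
  obtain ⟨κ, hκ⟩ := (Set.finite_range P.k).bddAbove
  have hκ' : ∀ i, P.k i ≤ max κ 0 := fun i => (hκ (mem_range_self i)).trans (le_max_left _ _)
  refine ⟨max κ 0 * (K * L), by positivity, fun i s t z w => ?_⟩
  rw [truncLaw, truncLaw, ← mul_sub, abs_mul, abs_neg, abs_of_pos (P.k_pos i), mul_assoc]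
  have h1 := hK.dist_le_mul _ (abs_le.1 (abs_clamp_le hr0 (psi P.T₁ P.c t z))) _
    (abs_le.1 (abs_clamp_le hr0 (psi P.T₁ P.c s w)))
  rw [Real.dist_eq, Real.dist_eq] at h1
  refine mul_le_mul (hκ' i) (h1.trans ?_) (abs_nonneg _) (le_max_right _ _)
  rw [mul_assoc]
  exact mul_le_mul_of_nonneg_left ((abs_clamp_sub_le _ _ _).trans (hL s t z w)) K.2

lemma chain_trunc_eq {P : Design n} {ρ t f r : ℝ} {x : Fin n → ℝ}
    (h : ∀ i, |psi P.T₁ P.c t (chainErr (truncLaw P ρ t) f r x i)| ≤ ρ) :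
    chain (truncLaw P ρ t) f r x = chain (designLaw P t) f r x :=
  chain_congr fun i => truncLaw_eq (h i)

lemma chain_trunc_eq' {P : Design n} {ρ t f r : ℝ} {x : Fin n → ℝ}
    (h : ∀ i, |psi P.T₁ P.c t (chainErr (designLaw P t) f r x i)| ≤ ρ) :
    chain (truncLaw P ρ t) f r x = chain (designLaw P t) f r x :=
  (chain_congr fun i => (truncLaw_eq (h i)).symm).symm

lemma exists_chain_lipschitz (P : Design n) {ρ : ℝ} (hρ0 : 0 ≤ ρ) (hρ1 : ρ < 1)
    (j : Fin (n + 1)) :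
    ∃ K, 0 ≤ K ∧ ∀ t f r x y, |f| ≤ 1 →
      |chain (truncLaw P ρ t) f r x j - chain (truncLaw P ρ t) f r y j| ≤ K * ‖x - y‖ := by
  obtain ⟨L, hL0, hL⟩ := exists_truncLaw_lipschitz P hρ0 hρ1
  induction j using Fin.induction with
  | zero => exact ⟨0, le_rfl, by simp⟩
  | succ i ih =>
    obtain ⟨K, hK0, hK⟩ := ih
    refine ⟨L * (1 + K), by positivity, fun t f r x y hf => ?_⟩
    rw [chain_succ, chain_succ, mul_assoc]
    refine (hL i t t _ _).trans (mul_le_mul_of_nonneg_left ?_ hL0)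
    rw [sub_self, abs_zero, zero_add, chainErr, chainErr, ← mul_sub, abs_mul]
    refine (mul_le_of_le_one_left (abs_nonneg _) hf).trans ?_
    rw [sub_sub_sub_comm, add_mul, one_mul]
    have h1 : |x i - y i| ≤ ‖x - y‖ := norm_le_pi_norm (x - y) i
    have h2 := hK t f r x y hf
    exact (abs_sub _ _).trans (add_le_add h1 h2)

lemma continuousOn_chain_trunc (P : Design n) {ρ : ℝ} (hρ0 : 0 ≤ ρ) (hρ1 : ρ < 1)
    {F g : ℝ → ℝ} {x : ℝ → Fin n → ℝ} {S : Set ℝ} (hF : ContinuousOn F S) (hg : ContinuousOn g S)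
    (hx : ContinuousOn x S) (j : Fin (n + 1)) :
    ContinuousOn (fun t => chain (truncLaw P ρ t) (F t) (g t) (x t) j) S := by
  obtain ⟨L, hL0, hL⟩ := exists_truncLaw_lipschitz P hρ0 hρ1
  induction j using Fin.induction with
  | zero => simpa using hg
  | succ i ih =>
    have hc : Continuous fun p : ℝ × ℝ => truncLaw P ρ p.1 i p.2 := by
      refine LipschitzWith.continuous (K := Real.toNNReal (L * 2))
        (LipschitzWith.of_dist_le' fun p q => ?_)
      refine (hL i q.1 p.1 p.2 q.2).trans ?_
      rw [mul_assoc, two_mul]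
      have h1 : |p.1 - q.1| ≤ dist p q := le_max_left _ _
      have h2 : |p.2 - q.2| ≤ dist p q := le_max_right _ _
      exact mul_le_mul_of_nonneg_left (add_le_add h1 h2) hL0
    have hz := hF.mul ((continuousOn_pi.1 hx i).sub ih)
    simp only [chain_succ, chainErr]
    have h := hc.comp_continuousOn ((continuousOn_id' S).prodMk hz)
    simpa only [Function.comp_def, Pi.mul_apply, Pi.sub_apply] using h

lemma continuousOn_psi_trunc (P : Design n) {ρ : ℝ} (hρ0 : 0 ≤ ρ) (hρ1 : ρ < 1)
    {F g : ℝ → ℝ} {x : ℝ → Fin n → ℝ} {S : Set ℝ} (hF : ContinuousOn F S) (hg : ContinuousOn g S)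
    (hx : ContinuousOn x S) (i : Fin n) :
    ContinuousOn
      (fun t => psi P.T₁ P.c t (chainErr (truncLaw P ρ t) (F t) (g t) (x t) i)) S :=
  continuousOn_psi P.T₁_pos P.c_pos
    (hF.mul ((continuousOn_pi.1 hx i).sub (continuousOn_chain_trunc P hρ0 hρ1 hF hg hx _)))

lemma continuousOn_withInput_trunc (P : Design n) {ρ : ℝ} (hρ0 : 0 ≤ ρ) (hρ1 : ρ < 1)
    {F g : ℝ → ℝ} {x : ℝ → Fin n → ℝ} {S : Set ℝ} (hF : ContinuousOn F S) (hg : ContinuousOn g S)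
    (hx : ContinuousOn x S) (j : Fin (n + 1)) :
    ContinuousOn (fun t => withInput (truncLaw P ρ t) (F t) (g t) (x t) j) S := by
  induction j using Fin.lastCases with
  | last => simpa [withInput] using continuousOn_chain_trunc P hρ0 hρ1 hF hg hx (Fin.last n)
  | cast i => simpa [withInput] using continuousOn_pi.1 hx i

lemma exists_withInput_lipschitz (P : Design n) {ρ : ℝ} (hρ0 : 0 ≤ ρ) (hρ1 : ρ < 1) :
    ∃ K, 0 ≤ K ∧ ∀ t f r x y j, |f| ≤ 1 →
      |withInput (truncLaw P ρ t) f r x j - withInput (truncLaw P ρ t) f r y j| ≤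
        K * ‖x - y‖ := by
  obtain ⟨K, hK0, hK⟩ := exists_chain_lipschitz P hρ0 hρ1 (Fin.last n)
  refine ⟨K + 1, by positivity, fun t f r x y j hf => ?_⟩
  rw [add_mul, one_mul]
  induction j using Fin.lastCases with
  | last =>
    have := hK t f r x y hf
    simp only [withInput, Fin.snoc_last]
    linarith [norm_nonneg (x - y)]
  | cast i =>
    have : |x i - y i| ≤ ‖x - y‖ := norm_le_pi_norm (x - y) i
    simp only [withInput, Fin.snoc_castSucc]
    linarith [mul_nonneg hK0 (norm_nonneg (x - y))]

lemma intervalIntegrable_of_bounded {d : ℝ → ℝ} (hdm : Measurable d) {D a b : ℝ} (ha : 0 ≤ a)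
    (hab : a ≤ b) (hd : ∀ t, 0 ≤ t → |d t| ≤ D) :
    IntervalIntegrable d MeasureTheory.volume a b := by
  rw [intervalIntegrable_iff, uIoc_of_le hab]
  refine MeasureTheory.Measure.integrableOn_of_bounded (M := D) (by simp)
    hdm.aestronglyMeasurable ?_
  exact (MeasureTheory.ae_restrict_iff' measurableSet_Ioc).2
    (.of_forall fun t ht => hd t (ha.trans ht.1.le))

/-- The closed loop with truncated laws has solutions on every interval. The disturbance is only
measurable in time, so the equation is solved for the state minus the integrated disturbance. -/
lemma exists_solvesOn_trunc (P : Design n) {ρ : ℝ} (hρ0 : 0 ≤ ρ) (hρ1 : ρ < 1)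
    {F g : ℝ → ℝ} {a b D : ℝ} (ha : 0 ≤ a) (hab : a ≤ b) (hF : ContinuousOn F (Icc a b))
    (hF1 : ∀ t ∈ Icc a b, |F t| ≤ 1) (hg : ContinuousOn g (Icc a b))
    {d : Fin n → ℝ → ℝ} (hdm : ∀ i, Measurable (d i)) (hd : ∀ i t, 0 ≤ t → |d i t| ≤ D)
    (xa : Fin n → ℝ) :
    ∃ x, x a = xa ∧ SolvesOn (loop (truncLaw P ρ) F g d) a b x := by
  have hdi : ∀ i, IntervalIntegrable (d i) MeasureTheory.volume a b := fun i =>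
    intervalIntegrable_of_bounded (hdm i) ha hab (hd i)
  set δ : ℝ → Fin n → ℝ := fun t i => ∫ s in a..t, d i s with hδ
  have hδc : ContinuousOn δ (Icc a b) := continuousOn_pi.2 fun i => by
    have := intervalIntegral.continuousOn_primitive_interval (μ := MeasureTheory.volume)
      ((intervalIntegrable_iff' (μ := MeasureTheory.volume)).1 (hdi i))
    rwa [uIcc_of_le hab] at this
  obtain ⟨K, hK0, hK⟩ := exists_withInput_lipschitz P hρ0 hρ1
  set V : ℝ → (Fin n → ℝ) → Fin n → ℝ := fun t y i =>
    withInput (truncLaw P ρ t) (F t) (g t) (y + δ t) i.succ with hV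
  obtain ⟨y, hya, hy⟩ := exists_hasDerivWithinAt_of_lipschitz (V := V) (K := Real.toNNReal K) hab
    (fun t ht => LipschitzWith.of_dist_le' fun x y =>
      (dist_pi_le_iff (by positivity)).2 fun i => by
        have := hK t (F t) (g t) (x + δ t) (y + δ t) i.succ (hF1 t ht)
        rwa [add_sub_add_right_eq_sub, ← dist_eq_norm] at this)
    (fun y => continuousOn_pi.2 fun i =>
      continuousOn_withInput_trunc P hρ0 hρ1 hF hg (continuousOn_const.add hδc) i.succ) xa
  have hyc : ContinuousOn y (Icc a b) := fun t ht => (hy t ht).continuousWithinAt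
  have hVc : ∀ i, ContinuousOn (fun t => V t (y t) i) (Icc a b) := fun i =>
    continuousOn_withInput_trunc P hρ0 hρ1 hF hg (hyc.add hδc) i.succ
  refine ⟨fun t => y t + δ t, by simp [hδ, hya]; rfl, fun i => ?_⟩
  have hVi : IntervalIntegrable (fun t => V t (y t) i) MeasureTheory.volume a b :=
    ContinuousOn.intervalIntegrable (by rw [uIcc_of_le hab]; exact hVc i)
  refine ⟨hVi.add (hdi i), fun t ht => ?_⟩
  have hsub : uIcc a t ⊆ uIcc a b := by
    rw [uIcc_of_le ht.1, uIcc_of_le hab]; exact Icc_subset_Icc_right ht.2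
  have hftc := intervalIntegral.integral_eq_sub_of_hasDeriv_right (a := a) (b := t)
    (f := fun t => y t i) (f' := fun t => V t (y t) i)
    ((continuousOn_pi.1 hyc i).mono (by rw [← uIcc_of_le hab]; exact hsub))
    (fun s hs => by
      rw [min_eq_left ht.1, max_eq_right ht.1] at hs
      exact (hasDerivWithinAt_pi.1 (hy s ⟨hs.1.le, hs.2.le.trans ht.2⟩) i).mono_of_mem_nhdsWithin
        (Icc_mem_nhdsGT_of_mem ⟨hs.1.le, hs.2.trans_le ht.2⟩))
    (hVi.mono_set hsub)
  have hsum := intervalIntegral.integral_add (hVi.mono_set hsub) ((hdi i).mono_set hsub)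
  change y t i + δ t i = y a i + δ a i + ∫ s in a..t, (V s (y s) i + d i s)
  rw [hsum, hftc, show δ a i = 0 by simp [hδ]]
  change y t i + δ t i = y a i + 0 + (y t i - y a i + δ t i)
  ring

/-! ### Invariance and existence between breakpoints -/

/-- Data of the closed loop on a time interval without jumps in its interior: the factor `F` and
the reference `g` are Lipschitz up to both end points, and `F` may vanish only at the left one. -/
structure IsPiece (F g : ℝ → ℝ) (a b : ℝ) : Prop where
  lipschitz_factor : ∃ K, LipschitzOnWith K F (Icc a b)
  lipschitz_reference : ∃ K, LipschitzOnWith K g (Icc a b)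
  nonneg : ∀ t ∈ Icc a b, 0 ≤ F t
  le_one : ∀ t ∈ Icc a b, F t ≤ 1
  pos : ∀ t ∈ Ioc a b, 0 < F t

lemma IsPiece.continuousOn_factor {F g : ℝ → ℝ} {a b : ℝ} (h : IsPiece F g a b) :
    ContinuousOn F (Icc a b) := h.lipschitz_factor.choose_spec.continuousOn

lemma IsPiece.continuousOn_reference {F g : ℝ → ℝ} {a b : ℝ} (h : IsPiece F g a b) :
    ContinuousOn g (Icc a b) := h.lipschitz_reference.choose_spec.continuousOn

lemma Inside.exists_lt {P : Design n} {f r t : ℝ} {x : Fin n → ℝ} (h : Inside P f r t x) :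
    ∃ ρ, 0 < ρ ∧ ρ < 1 ∧
      ∀ i, |psi P.T₁ P.c t (chainErr (designLaw P t) f r x i)| < ρ := by
  rcases isEmpty_or_nonempty (Fin n) with he | hne
  · exact ⟨1 / 2, by norm_num, by norm_num, fun i => he.elim i⟩
  · obtain ⟨m, hm⟩ := Finite.exists_max
      fun i => |psi P.T₁ P.c t (chainErr (designLaw P t) f r x i)|
    obtain ⟨ρ, h1, h2⟩ := exists_between (h m)
    exact ⟨ρ, (abs_nonneg _).trans_lt h1, h2, fun i => (hm i).trans_lt h1⟩

/-- The truncation with level `ρ` is inactive at time `t` and state `x`. -/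
def Inactive (P : Design n) (ρ : ℝ) (F g : ℝ → ℝ) (t : ℝ) (x : Fin n → ℝ) : Prop :=
  ∀ i, |psi P.T₁ P.c t (chainErr (truncLaw P ρ t) (F t) (g t) x i)| ≤ ρ

lemma Inactive.chain_eq {P : Design n} {ρ t : ℝ} {F g : ℝ → ℝ} {x : Fin n → ℝ}
    (h : Inactive P ρ F g t x) :
    chain (truncLaw P ρ t) (F t) (g t) x = chain (designLaw P t) (F t) (g t) x :=
  chain_trunc_eq h

lemma Inactive.inside {P : Design n} {ρ t : ℝ} {F g : ℝ → ℝ} {x : Fin n → ℝ}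
    (h : Inactive P ρ F g t x) (hρ : ρ < 1) : Inside P (F t) (g t) t x := fun i => by
  have h1 := h i
  rw [chainErr, h.chain_eq] at h1
  exact h1.trans_lt hρ

lemma Inactive.loop_eq {P : Design n} {ρ t : ℝ} {F g : ℝ → ℝ} {x : Fin n → ℝ}
    (h : Inactive P ρ F g t x) (d : Fin n → ℝ → ℝ) :
    loop (truncLaw P ρ) F g d t x = loop (designLaw P) F g d t x := by
  funext i
  rw [loop, loop, withInput, withInput, h.chain_eq]

/-- For a short time after a start inside the boundary the truncation is inactive. -/
lemma exists_inactive_right {P : Design n} {F g : ℝ → ℝ} {a b ρ : ℝ} (hab : a < b)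
    (hp : IsPiece F g a b) (hρ0 : 0 < ρ) (hρ1 : ρ < 1) {x : ℝ → Fin n → ℝ}
    (hx : ContinuousOn x (Icc a b))
    (hxa : ∀ i, |psi P.T₁ P.c a (chainErr (designLaw P a) (F a) (g a) (x a) i)| < ρ) :
    ∃ c ∈ Ioc a b, ∀ t ∈ Icc a c, Inactive P ρ F g t (x t) := by
  have hev : ∀ᶠ t in nhdsWithin a (Ici a), ∀ i,
      |psi P.T₁ P.c t (chainErr (truncLaw P ρ t) (F t) (g t) (x t) i)| < ρ := by
    refine Filter.eventually_all.2 fun i => ?_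
    have hc := (continuousOn_psi_trunc P hρ0.le hρ1 hp.continuousOn_factor
      hp.continuousOn_reference hx i).abs a (left_mem_Icc.2 hab.le)
    rw [ContinuousWithinAt, nhdsWithin_Icc_eq_nhdsGE hab] at hc
    refine hc.eventually_lt_const ?_
    have h1 := hxa i
    rwa [chainErr, ← chain_trunc_eq' fun i => (hxa i).le] at h1
  obtain ⟨u, hu, hsub⟩ := mem_nhdsGE_iff_exists_Icc_subset.1 hev
  exact ⟨min u b, ⟨lt_min hu hab, min_le_right _ _⟩,
    fun t ht i => (hsub ⟨ht.1, ht.2.trans (min_le_left _ _)⟩ i).le⟩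

/-- If all confined solutions keep a margin `r`, then a curve that is a solution as long as the
truncation with level `ρ > r` is inactive never activates it. -/
lemma inactive_of_margin {P : Design n} {F g : ℝ → ℝ} {d : Fin n → ℝ → ℝ} {a b r ρ : ℝ}
    (hp : IsPiece F g a b) {x : ℝ → Fin n → ℝ} (hxa : Inside P (F a) (g a) a (x a))
    (hr0 : 0 < r) (hrρ : r < ρ) (hρ1 : ρ < 1)
    (hr : ∀ t' ∈ Icc a b, ∀ y, Confined P F g d a (x a) t' y → ∀ t ∈ Icc a t', ∀ i,
      |psi P.T₁ P.c t (chainErr (designLaw P t) (F t) (g t) (y t) i)| ≤ r)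
    (hx : ContinuousOn x (Icc a b))
    (hsol : ∀ t' ∈ Icc a b, (∀ t ∈ Icc a t', Inactive P ρ F g t (x t)) →
      SolvesOn (loop (designLaw P) F g d) a t' x) :
    ∀ t ∈ Icc a b, Inactive P ρ F g t (x t) := by
  have hρ0 := hr0.trans hrρ
  have hcont := fun i => (continuousOn_psi_trunc P hρ0.le hρ1 hp.continuousOn_factor
      hp.continuousOn_reference hx i).abs
  by_contra! hne
  obtain ⟨t₀, ht₀, hne⟩ := hne
  have hab : a ≤ b := ht₀.1.trans ht₀.2
  -- the first time at which some truncated error reaches the level `ρ`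
  have hclosed : IsClosed {t ∈ Icc a b | ∃ i, ρ ≤
      |psi P.T₁ P.c t (chainErr (truncLaw P ρ t) (F t) (g t) (x t) i)|} := by
    have : {t ∈ Icc a b | ∃ i, ρ ≤
        |psi P.T₁ P.c t (chainErr (truncLaw P ρ t) (F t) (g t) (x t) i)|} =
        ⋃ i, Icc a b ∩ (fun t =>
          |psi P.T₁ P.c t (chainErr (truncLaw P ρ t) (F t) (g t) (x t) i)|) ⁻¹' Ici ρ := by
      ext t; simp
    rw [this]
    exact isClosed_iUnion_of_finite fun i =>
      (hcont i).preimage_isClosed_of_isClosed isClosed_Icc isClosed_Ici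
  obtain ⟨t₁, ⟨ht₁, j, hj⟩, hmin⟩ := (isCompact_Icc.of_isClosed_subset hclosed
    fun t ht => ht.1).exists_isLeast (by
      simp only [Inactive, not_forall, not_le] at hne
      obtain ⟨i, hi⟩ := hne
      exact ⟨t₀, ht₀, i, hi.le⟩)
  have hbefore : ∀ t ∈ Ico a t₁, Inactive P ρ F g t (x t) := fun t ht i => by
    by_contra! h
    exact ht.2.not_ge (hmin ⟨⟨ht.1, ht.2.le.trans ht₁.2⟩, i, h.le⟩)
  have hlt : ∀ t ∈ Ico a t₁,
      |psi P.T₁ P.c t (chainErr (truncLaw P ρ t) (F t) (g t) (x t) j)| ≤ r := fun t ht => by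
    have htb : t ∈ Icc a b := ⟨ht.1, ht.2.le.trans ht₁.2⟩
    have hin : ∀ s ∈ Icc a t, Inactive P ρ F g s (x s) := fun s hs =>
      hbefore s ⟨hs.1, hs.2.trans_lt ht.2⟩
    rw [chainErr, (hin t ⟨ht.1, le_rfl⟩).chain_eq]
    exact hr t htb x ⟨rfl, hsol t htb hin, fun s hs => (hin s hs).inside hρ1⟩ t ⟨ht.1, le_rfl⟩ j
  have hle : |psi P.T₁ P.c t₁ (chainErr (truncLaw P ρ t₁) (F t₁) (g t₁) (x t₁) j)| ≤ r := by
    rcases ht₁.1.eq_or_lt with rfl | hat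
    · -- at the left end point the constant curve is a confined solution
      have h1 := hr a ⟨le_rfl, hab⟩ (fun _ => x a) ⟨rfl, fun i => ⟨by simp, fun t ht => by
        rw [le_antisymm ht.2 ht.1]; simp⟩, fun t ht => by
        rw [le_antisymm ht.2 ht.1]; exact hxa⟩ a ⟨le_rfl, le_rfl⟩
      rw [chainErr, chain_trunc_eq' fun i => (h1 i).trans hrρ.le]
      exact h1 j
    · have hcl : t₁ ∈ closure (Ico a t₁) := by
        rw [closure_Ico hat.ne]; exact ⟨hat.le, le_rfl⟩
      exact ContinuousWithinAt.closure_le hcl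
        ((hcont j t₁ ht₁).mono fun t ht => ⟨ht.1, ht.2.le.trans ht₁.2⟩)
        continuousWithinAt_const hlt
  exact (hle.trans_lt hrρ).not_ge hj

lemma IsPiece.exists_margin {P : Design n} {F g : ℝ → ℝ} {d : Fin n → ℝ → ℝ} {a b c D : ℝ}
    (hp : IsPiece F g a b) (ha : 0 ≤ a) (hc : c ∈ Ioc a b) (hd : ∀ i t, 0 ≤ t → |d i t| ≤ D)
    {xc : Fin n → ℝ} (hxc : Inside P (F c) (g c) c xc) :
    ∃ r, 0 < r ∧ r < 1 ∧ ∀ t' ∈ Icc c b, ∀ y, Confined P F g d c xc t' y → ∀ t ∈ Icc c t', ∀ i,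
      |psi P.T₁ P.c t (chainErr (designLaw P t) (F t) (g t) (y t) i)| ≤ r := by
  have hsub : Icc c b ⊆ Icc a b := Icc_subset_Icc_left hc.1.le
  obtain ⟨KF, hKF⟩ := hp.lipschitz_factor
  obtain ⟨Kg, hKg⟩ := hp.lipschitz_reference
  obtain ⟨m, hm, hmin⟩ := isCompact_Icc.exists_isMinOn (nonempty_Icc.2 hc.2)
    (hp.continuousOn_factor.mono hsub)
  exact exists_uniform_margin P (ha.trans_lt hc.1) (hp.pos m ⟨hc.1.trans_le hm.1, hm.2⟩)
    (fun t ht => hmin ht) (fun t ht => hp.le_one t (hsub ht)) (hKF.mono hsub) (hKg.mono hsub)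
    hd hxc

lemma IsPiece.mono_left {F g : ℝ → ℝ} {a b c : ℝ} (hp : IsPiece F g a b) (hc : a ≤ c) :
    IsPiece F g c b where
  lipschitz_factor := hp.lipschitz_factor.imp fun _ h => h.mono (Icc_subset_Icc_left hc)
  lipschitz_reference := hp.lipschitz_reference.imp fun _ h => h.mono (Icc_subset_Icc_left hc)
  nonneg t ht := hp.nonneg t ⟨hc.trans ht.1, ht.2⟩
  le_one t ht := hp.le_one t ⟨hc.trans ht.1, ht.2⟩
  pos t ht := hp.pos t ⟨hc.trans_lt ht.1, ht.2⟩

/-- Every solution on a piece that starts inside the boundary stays inside. -/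
lemma IsPiece.inside_of_solvesOn {P : Design n} {F g : ℝ → ℝ} {d : Fin n → ℝ → ℝ} {a b D : ℝ}
    (hp : IsPiece F g a b) (ha : 0 ≤ a) (hab : a < b) (hd : ∀ i t, 0 ≤ t → |d i t| ≤ D)
    {x : ℝ → Fin n → ℝ} (hx : SolvesOn (loop (designLaw P) F g d) a b x)
    (hxa : Inside P (F a) (g a) a (x a)) : ∀ t ∈ Icc a b, Inside P (F t) (g t) t (x t) := by
  obtain ⟨ρ₀, h0, h1, hρ₀⟩ := hxa.exists_lt
  have hxc := hx.continuousOn hab.le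
  obtain ⟨c, hc, hstart⟩ := exists_inactive_right hab hp h0 h1 hxc hρ₀
  have hic := (hstart c ⟨hc.1.le, le_rfl⟩).inside h1
  obtain ⟨r, hr0, hr1, hr⟩ := hp.exists_margin ha hc hd hic
  obtain ⟨ρ, hrρ, hρ1⟩ := exists_between hr1
  have hend := inactive_of_margin (hp.mono_left hc.1.le) hic hr0 hrρ hρ1 hr
    (hxc.mono (Icc_subset_Icc_left hc.1.le)) fun t' ht' _ => hx.mono hc.1.le ht'.1 ht'.2
  intro t ht
  rcases le_total t c with h | h
  · exact (hstart t ⟨ht.1, h⟩).inside h1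
  · exact (hend t ⟨h, ht.2⟩).inside hρ1

/-- On a piece there is a solution through every initial state inside the boundary. -/
lemma IsPiece.exists_solvesOn {P : Design n} {F g : ℝ → ℝ} {d : Fin n → ℝ → ℝ} {a b D : ℝ}
    (hp : IsPiece F g a b) (ha : 0 ≤ a) (hab : a < b) (hdm : ∀ i, Measurable (d i))
    (hd : ∀ i t, 0 ≤ t → |d i t| ≤ D) {xa : Fin n → ℝ} (hxa : Inside P (F a) (g a) a xa) :
    ∃ x, x a = xa ∧ SolvesOn (loop (designLaw P) F g d) a b x := by
  have hF1 : ∀ t ∈ Icc a b, |F t| ≤ 1 := fun t ht => by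
    rw [abs_of_nonneg (hp.nonneg t ht)]; exact hp.le_one t ht
  obtain ⟨ρ₀, h0, h1, hρ₀⟩ := hxa.exists_lt
  obtain ⟨x, rfl, hx⟩ := exists_solvesOn_trunc P h0.le h1 ha hab.le hp.continuousOn_factor hF1
    hp.continuousOn_reference hdm hd xa
  obtain ⟨c, hc, hstart⟩ := exists_inactive_right hab hp h0 h1 (hx.continuousOn hab.le) hρ₀
  have hic := (hstart c ⟨hc.1.le, le_rfl⟩).inside h1
  obtain ⟨r, hr0, hr1, hr⟩ := hp.exists_margin ha hc hd hic
  obtain ⟨ρ, hrρ, hρ1⟩ := exists_between hr1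
  have hsub : Icc c b ⊆ Icc a b := Icc_subset_Icc_left hc.1.le
  obtain ⟨y, hyc, hy⟩ := exists_solvesOn_trunc P (hr0.trans hrρ).le hρ1 (ha.trans hc.1.le) hc.2
    (hp.continuousOn_factor.mono hsub) (fun t ht => hF1 t (hsub ht))
    (hp.continuousOn_reference.mono hsub) hdm hd (x c)
  rw [← hyc] at hic hr
  have hend := inactive_of_margin (hp.mono_left hc.1.le) hic hr0 hrρ hρ1 hr
    (hy.continuousOn hc.2) fun t' ht' h => (hy.mono le_rfl ht'.1 ht'.2).congr ht'.1
      fun t ht => (h t ⟨ht.1.le, ht.2⟩).loop_eq d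
  refine ⟨_, ?_, SolvesOn.glue (((hx.mono le_rfl hc.1.le hc.2).congr hc.1.le
    fun t ht => (hstart t ⟨ht.1.le, ht.2⟩).loop_eq d))
    (hy.congr hc.2 fun t ht => (hend t ⟨ht.1.le, ht.2⟩).loop_eq d) hc.1.le hc.2 hyc.symm⟩
  simp [hc.1.le]

/-! ### Passing through the breakpoints -/

/-- The factor as a function of the set `A` of the jump times that lie in the past. -/
noncomputable def shift (T : ℝ) (A : Finset ℝ) (t : ℝ) : ℝ :=
  if hA : A.Nonempty then mu T (t - A.max' hA) else 1

lemma factor_eq_shift (T : ℝ) (J : Finset ℝ) (t : ℝ) :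
    factor T J t = shift T (J.filter (fun τ => τ < t)) t := rfl

lemma factor_of_forall_le {T t : ℝ} {J : Finset ℝ} (h : ∀ τ ∈ J, t ≤ τ) : factor T J t = 1 := by
  have : J.filter (fun τ => τ < t) = ∅ :=
    Finset.filter_eq_empty_iff.2 fun τ hτ => not_lt.2 (h τ hτ)
  rw [factor_eq_shift, this, shift, dif_neg Finset.not_nonempty_empty]

/-- The factor is `1` from time `T` after a jump until the next jump. -/
lemma factor_of_add_le {T t τ : ℝ} {J : Finset ℝ} (hT : 0 < T) (hτ : τ ∈ J) (ht : τ + T ≤ t)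
    (h : ∀ τ' ∈ J, τ < τ' → t ≤ τ') : factor T J t = 1 := by
  have hmem : τ ∈ J.filter (fun τ => τ < t) := Finset.mem_filter.2 ⟨hτ, by linarith⟩
  have hmax : (J.filter (fun τ => τ < t)).max' ⟨τ, hmem⟩ ≤ τ := by
    refine Finset.max'_le _ _ _ fun σ hσ => ?_
    rw [Finset.mem_filter] at hσ
    by_contra! hlt
    exact hσ.2.not_ge (h σ hσ.1 hlt)
  rw [factor, dif_pos ⟨τ, hmem⟩]
  exact mu_of_ge hT (by linarith)

lemma exists_lipschitz_shift {T : ℝ} (hT : 0 < T) (A : Finset ℝ) :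
    ∃ K, LipschitzWith K (shift T A) := by
  unfold shift
  split_ifs with hA
  · obtain ⟨K, hK⟩ := exists_lipschitz_mu hT
    refine ⟨K, fun s t => ?_⟩
    have := hK (s - A.max' hA) (t - A.max' hA)
    rwa [edist_sub_right] at this
  · exact ⟨0, LipschitzWith.const 1⟩

/-- Between breakpoints the factor and the reference extend to a piece. At a jump the extended
factor starts from `0`; elsewhere the extension agrees with the original data. -/
lemma exists_isPiece {T a b : ℝ} {J : Finset ℝ} {xr : ℝ → ℝ} (hT : 0 < T) (hab : a < b)
    (hJ : ∀ τ ∈ J, τ ∉ Ioo a b)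
    (hsmooth : ∃ g : ℝ → ℝ, ContDiffOn ℝ 1 g (Icc a b) ∧ EqOn xr g (Ioc a b))
    (hcont : a ∉ J → ContinuousWithinAt xr (Ici a) a) :
    ∃ F g, IsPiece F g a b ∧ EqOn (factor T J) F (Ioc a b) ∧ EqOn xr g (Ioc a b) ∧
      (a ∈ J → F a = 0) ∧ (a ∉ J → F a = factor T J a ∧ g a = xr a) := by
  obtain ⟨g, hg, hxg⟩ := hsmooth
  set A := J.filter (fun τ => τ ≤ a) with hA
  obtain ⟨KF, hKF⟩ := exists_lipschitz_shift hT A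
  refine ⟨shift T A, g, ⟨⟨KF, hKF.lipschitzOnWith⟩,
    hg.exists_lipschitzOnWith one_ne_zero (convex_Icc _ _) isCompact_Icc, fun t _ => ?_,
    fun t _ => ?_, fun t ht => ?_⟩, fun t ht => ?_, hxg, fun ha => ?_, fun ha => ⟨?_, ?_⟩⟩
  · unfold shift
    split_ifs
    exacts [mu_nonneg hT _, zero_le_one]
  · unfold shift
    split_ifs
    exacts [mu_le_one hT _, le_rfl]
  · unfold shift
    split_ifs with h
    · have : A.max' h ≤ a := Finset.max'_le _ _ _ fun τ hτ => (Finset.mem_filter.1 hτ).2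
      exact mu_pos hT (by linarith [ht.1])
    · exact one_pos
  · have : J.filter (fun τ => τ < t) = A := Finset.filter_congr fun τ hτ =>
      ⟨fun h => by
        by_contra! h'
        exact hJ τ hτ ⟨h', h.trans_le ht.2⟩, fun h => h.trans_lt ht.1⟩
    rw [factor_eq_shift, this]
  · have hmem : a ∈ A := Finset.mem_filter.2 ⟨ha, le_rfl⟩
    rw [shift, dif_pos ⟨a, hmem⟩]
    exact mu_of_le (sub_nonpos.2 (Finset.le_max' _ _ hmem))
  · have : J.filter (fun τ => τ < a) = A := Finset.filter_congr fun τ hτ =>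
      ⟨le_of_lt, fun h => lt_of_le_of_ne h fun h' => ha (h' ▸ hτ)⟩
    rw [factor_eq_shift, this]
  · have h1 : Filter.Tendsto xr (nhdsWithin a (Ioc a b)) (nhds (xr a)) :=
      (hcont ha).mono fun t ht => ht.1.le
    have h2 : Filter.Tendsto xr (nhdsWithin a (Ioc a b)) (nhds (g a)) :=
      (((hg.continuousOn a (left_mem_Icc.2 hab.le)).mono Ioc_subset_Icc_self).tendsto).congr'
        (eventually_mem_nhdsWithin.mono fun t ht => (hxg ht).symm)
    have : (nhdsWithin a (Ioc a b)).NeBot := by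
      rw [nhdsWithin_Ioc_eq_nhdsGT hab]; infer_instance
    exact tendsto_nhds_unique h2 h1

/-- A piecewise smooth function on `[0, B]` has finitely many breakpoints, between which it extends
to a continuously differentiable function. -/
lemma PiecewiseSmooth.exists_breakpoints {f : ℝ → ℝ} (hf : PiecewiseSmooth f) {B : ℝ}
    (hB : 0 < B) : ∃ S : Finset ℝ, ∀ a b, 0 ≤ a → a < b → b ≤ B → (∀ s ∈ S, s ∉ Ioo a b) →
      ∃ g : ℝ → ℝ, ContDiffOn ℝ 1 g (Icc a b) ∧ EqOn f g (Ioc a b) := by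
  obtain ⟨m, s, hs0, hsm, _, hsg⟩ := hf B hB
  refine ⟨(Finset.range (m + 1)).image s, fun a b ha hab hb hS => ?_⟩
  have hex : ∃ k, b ≤ s k := ⟨m, by rw [hsm]; exact hb⟩
  classical
  obtain ⟨j, hj⟩ : ∃ j, Nat.find hex = j + 1 := Nat.exists_eq_succ_of_ne_zero fun h0 => by
    have := Nat.find_spec hex
    rw [h0, hs0] at this
    linarith
  have hb' : b ≤ s (j + 1) := hj ▸ Nat.find_spec hex
  have hjm : j + 1 ≤ m := hj ▸ Nat.find_min' hex (by rw [hsm]; exact hb)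
  have hjb : s j < b := not_le.1 (Nat.find_min hex (by omega))
  have hja : s j ≤ a := by
    by_contra! h
    exact hS (s j) (Finset.mem_image_of_mem s (Finset.mem_range.2 (by omega))) ⟨h, hjb⟩
  obtain ⟨g, hg, hfg⟩ := hsg j (by omega)
  exact ⟨g, hg.mono (Icc_subset_Icc hja hb'), hfg.mono (Ioc_subset_Ioc hja hb')⟩

/-- A transitive relation that holds between points without breakpoints in between holds between
all points. -/
lemma forall_of_breakpoints (S : Finset ℝ) {R : ℝ → ℝ → Prop}
    (trans : ∀ a b c, a < b → b < c → R a b → R b c → R a c)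
    (base : ∀ a b, a < b → (∀ s ∈ S, s ∉ Ioo a b) → R a b) {a b : ℝ} (hab : a < b) : R a b := by
  classical
  induction hN : (S.filter (fun s => s ∈ Ioo a b)).card using Nat.strong_induction_on
    generalizing a b with
  | _ N ih =>
    by_cases h : ∀ s ∈ S, s ∉ Ioo a b
    · exact base a b hab h
    · push Not at h
      obtain ⟨s, hsS, hs⟩ := h
      have hmem : s ∈ S.filter (fun s => s ∈ Ioo a b) := Finset.mem_filter.2 ⟨hsS, hs⟩
      have hcard : ∀ a' b', Ioo a' b' ⊆ Ioo a b → s ∉ Ioo a' b' →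
          (S.filter (fun s => s ∈ Ioo a' b')).card < N := fun a' b' hsub hns => by
        rw [← hN]
        refine Finset.card_lt_card ⟨fun u hu => ?_, fun hle => ?_⟩
        · rw [Finset.mem_filter] at hu ⊢
          exact ⟨hu.1, hsub hu.2⟩
        · exact hns (Finset.mem_filter.1 (hle hmem)).2
      exact trans a s b hs.1 hs.2
        (ih _ (hcard a s (Ioo_subset_Ioo_right hs.2.le) fun h => lt_irrefl _ h.2) hs.1 rfl)
        (ih _ (hcard s b (Ioo_subset_Ioo_left hs.1.le) fun h => lt_irrefl _ h.1) hs.2 rfl)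

/-- All transformed errors of the closed loop at time `t` and state `y` are inside `(-1, 1)`. -/
def InsideAt (P : Design n) (J : Finset ℝ) (xr : ℝ → ℝ) (t : ℝ) (y : Fin n → ℝ) : Prop :=
  Inside P (factor P.T J t) (xr t) t y

lemma insideAt_zero (P : Design n) (J : Finset ℝ) (xr : ℝ → ℝ) (y : Fin n → ℝ) :
    InsideAt P J xr 0 y := fun _ => abs_psi_zero_lt_one P.T₁_pos P.c_pos _

/-- Between consecutive breakpoints up to time `B` the closed loop is given by a piece, and states
inside the boundary at the left end point are inside for the data of the piece. -/
lemma exists_breakpoints {P : Design n} {J : Finset ℝ} {xr : ℝ → ℝ} (hxr : IsReference P.T J xr)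
    {B : ℝ} (hB : 0 < B) : ∃ S : Finset ℝ, ∀ a b, 0 ≤ a → a < b → b ≤ B →
      (∀ s ∈ S, s ∉ Ioo a b) → ∃ F g, IsPiece F g a b ∧ EqOn (factor P.T J) F (Ioc a b) ∧
        EqOn xr g (Ioc a b) ∧ ∀ y, InsideAt P J xr a y → Inside P (F a) (g a) a y := by
  classical
  obtain ⟨S, hS⟩ := hxr.piecewiseSmooth.exists_breakpoints hB
  refine ⟨S ∪ J, fun a b ha hab hb hSJ => ?_⟩
  obtain ⟨F, g, hp, hF, hg, hjump, hno⟩ := exists_isPiece P.T_pos hab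
    (fun τ hτ => hSJ τ (Finset.mem_union_right _ hτ))
    (hS a b ha hab hb fun s hs => hSJ s (Finset.mem_union_left _ hs))
    (fun haJ => by
      have := not_not.1 (mt (hxr.mem_iff a ha).2 haJ)
      exact this.mono (Ici_subset_Ici.2 ha))
  refine ⟨F, g, hp, hF, hg, fun y hy => ?_⟩
  by_cases haJ : a ∈ J
  · intro i
    rw [chainErr, hjump haJ, zero_mul, psi_zero, abs_zero]
    exact one_pos
  · rw [(hno haJ).1, (hno haJ).2]
    exact hy

lemma loop_congr {φ : ℝ → Fin n → ℝ → ℝ} {F F' g g' : ℝ → ℝ} {d : Fin n → ℝ → ℝ} {t : ℝ}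
    (hF : F t = F' t) (hg : g t = g' t) (x : Fin n → ℝ) :
    loop φ F g d t x = loop φ F' g' d t x := by
  funext i
  rw [loop, loop, hF, hg]

/-- Every solution of the closed loop stays inside the boundary. -/
theorem insideAt_of_solvesOn {P : Design n} {J : Finset ℝ} {xr : ℝ → ℝ}
    (hxr : IsReference P.T J xr) {d : Fin n → ℝ → ℝ} {D : ℝ} (hd : ∀ i t, 0 ≤ t → |d i t| ≤ D)
    {B : ℝ} {x : ℝ → Fin n → ℝ}
    (hx : SolvesOn (loop (designLaw P) (factor P.T J) xr d) 0 B x) :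
    ∀ t ∈ Icc 0 B, InsideAt P J xr t (x t) := by
  intro t ht
  rcases ht.1.eq_or_lt with rfl | ht0
  · exact insideAt_zero P J xr _
  have hB := ht0.trans_le ht.2
  obtain ⟨S, hS⟩ := exists_breakpoints hxr hB
  refine forall_of_breakpoints S (R := fun a b => 0 ≤ a → b ≤ B → InsideAt P J xr a (x a) →
    InsideAt P J xr b (x b)) (fun a b c hab hbc h1 h2 ha hc h => ?_)
    (fun a b hab hno ha hb h => ?_) ht0 le_rfl ht.2 (insideAt_zero P J xr _)
  · exact h2 (ha.trans hab.le) hc (h1 ha (hbc.le.trans hc) h)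
  · obtain ⟨F, g, hp, hF, hg, hstart⟩ := hS a b ha hab hb hno
    have hsol : SolvesOn (loop (designLaw P) F g d) a b x :=
      (hx.mono ha hab.le hb).congr hab.le fun t ht => loop_congr (hF ht) (hg ht) _
    have hbm : b ∈ Ioc a b := ⟨hab, le_rfl⟩
    have := hp.inside_of_solvesOn ha hab hd hsol (hstart _ h) b ⟨hab.le, le_rfl⟩
    rwa [← hF hbm, ← hg hbm] at this

/-- Every solution on `[0, a]` extends to `[0, b]`. -/
theorem exists_extension {P : Design n} {J : Finset ℝ} {xr : ℝ → ℝ}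
    (hxr : IsReference P.T J xr) {d : Fin n → ℝ → ℝ} {D : ℝ} (hdm : ∀ i, Measurable (d i))
    (hd : ∀ i t, 0 ≤ t → |d i t| ≤ D) {a b : ℝ} (ha : 0 ≤ a) (hab : a < b) {x : ℝ → Fin n → ℝ}
    (hx : SolvesOn (loop (designLaw P) (factor P.T J) xr d) 0 a x) :
    ∃ y, EqOn y x (Icc 0 a) ∧ SolvesOn (loop (designLaw P) (factor P.T J) xr d) 0 b y := by
  obtain ⟨S, hS⟩ := exists_breakpoints hxr (ha.trans_lt hab)
  refine forall_of_breakpoints S (R := fun a' b' => 0 ≤ a' → b' ≤ b → ∀ x,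
    SolvesOn (loop (designLaw P) (factor P.T J) xr d) 0 a' x →
    ∃ y, EqOn y x (Icc 0 a') ∧ SolvesOn (loop (designLaw P) (factor P.T J) xr d) 0 b' y)
    (fun a b c hab hbc h1 h2 ha hc x hx => ?_) (fun a b hab hno ha hb x hx => ?_)
    hab ha le_rfl x hx
  · obtain ⟨y, hyx, hy⟩ := h1 ha (hbc.le.trans hc) x hx
    obtain ⟨z, hzy, hz⟩ := h2 (ha.trans hab.le) hc y hy
    exact ⟨z, fun t ht => (hzy ⟨ht.1, ht.2.trans hab.le⟩).trans (hyx ht), hz⟩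
  · obtain ⟨F, g, hp, hF, hg, hstart⟩ := hS a b ha hab hb hno
    obtain ⟨z, hza, hz⟩ := hp.exists_solvesOn ha hab hdm hd
      (hstart _ (insideAt_of_solvesOn hxr hd hx a ⟨ha, le_rfl⟩))
    refine ⟨_, fun t ht => ?_, hx.glue (hz.congr hab.le fun t ht =>
      loop_congr (hF ht).symm (hg ht).symm _) ha hab.le hza.symm⟩
    simp [ht.2]

/-- The closed loop has a solution on `[0, ∞)`. -/
theorem exists_global_solution {P : Design n} {J : Finset ℝ} {xr : ℝ → ℝ}
    (hxr : IsReference P.T J xr) {d : Fin n → ℝ → ℝ} {D : ℝ} (hdm : ∀ i, Measurable (d i))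
    (hd : ∀ i t, 0 ≤ t → |d i t| ≤ D) (x₀ : Fin n → ℝ) :
    ∃ x, x 0 = x₀ ∧
      ∀ b, 0 < b → SolvesOn (loop (designLaw P) (factor P.T J) xr d) 0 b x := by
  set G := loop (designLaw P) (factor P.T J) xr d
  have hstep : ∀ k : ℕ, ∀ x : {x // SolvesOn G 0 k x}, ∃ y : {y // SolvesOn G 0 (k + 1 : ℕ) y},
      EqOn y.1 x.1 (Icc 0 (k : ℝ)) := fun k x => by
    obtain ⟨y, hyx, hy⟩ := exists_extension (b := (k + 1 : ℕ)) hxr hdm hd k.cast_nonneg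
      (by push_cast; linarith) x.2
    exact ⟨⟨y, hy⟩, hyx⟩
  choose next hnext using hstep
  let X : ∀ k : ℕ, {x // SolvesOn G 0 k x} := fun k =>
    Nat.rec ⟨fun _ => x₀, fun i => ⟨by simp, fun t ht => by
      have ht2 : t ≤ 0 := by simpa using ht.2
      rw [le_antisymm ht2 ht.1]; simp⟩⟩ next k
  have hX : ∀ k l, k ≤ l → EqOn (X l).1 (X k).1 (Icc 0 (k : ℝ)) := fun k l hkl => by
    induction l, hkl using Nat.le_induction with
    | base => exact fun _ _ => rfl
    | succ l hkl ih =>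
      intro t ht
      have hl : t ∈ Icc 0 (l : ℝ) := ⟨ht.1, ht.2.trans (by exact_mod_cast hkl)⟩
      exact (hnext l (X l) hl).trans (ih ht)
  refine ⟨fun t => (X ⌈t⌉₊).1 t, ?_, fun b hb => ?_⟩
  · change (X ⌈(0 : ℝ)⌉₊).1 0 = x₀
    rw [Nat.ceil_zero]
    rfl
  · refine ((X ⌈b⌉₊).2.mono le_rfl hb.le (Nat.le_ceil b)).congr_left (fun t ht => ?_) hb.le
    exact hX _ _ (Nat.ceil_mono ht.2) ⟨ht.1, Nat.le_ceil t⟩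

end PPC

theorem theorem1 (n : ℕ) (P : PPC.Design n) (J : Finset ℝ) (xr : ℝ → ℝ)
    (hxr : PPC.IsReference P.T J xr)
    (d : Fin n → ℝ → ℝ) (hd_meas : ∀ i, Measurable (d i))
    (hd_bdd : ∃ D : ℝ, ∀ i, ∀ t, 0 ≤ t → |d i t| ≤ D)
    (x₀ : Fin n → ℝ) :
    -- the closed loop has a solution for all time
    (∃ x : ℝ → Fin n → ℝ, x 0 = x₀ ∧ ∀ b, 0 < b → PPC.IsSolution P J xr d b x) ∧
    -- and every solution, on any time interval `[0, b]`, has the following properties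
    (∀ b, 0 < b → ∀ x : ℝ → Fin n → ℝ, x 0 = x₀ → PPC.IsSolution P J xr d b x →
      -- the modified errors stay strictly inside the boundary
      (∀ i, ∀ t ∈ Set.Ioc 0 b, |PPC.modErr P J xr t (x t) i| < PPC.rho P.T₁ P.c t) ∧
      -- without jumps the errors stay strictly inside the boundary
      (J = ∅ → ∀ i, ∀ t ∈ Set.Ioc 0 b, |PPC.err P J xr t (x t) i| < PPC.rho P.T₁ P.c t) ∧
      -- with jumps the errors are inside the boundary until the first jump,
      (∀ i, ∀ t ∈ Set.Ioc 0 b, (∀ τ ∈ J, t ≤ τ) →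
        |PPC.err P J xr t (x t) i| < PPC.rho P.T₁ P.c t) ∧
      -- and from time `T` after each jump until the next jump
      (∀ τ ∈ J, ∀ i, ∀ t ∈ Set.Icc (τ + P.T) b, (∀ τ' ∈ J, τ < τ' → t ≤ τ') →
        PPC.modErr P J xr t (x t) i = PPC.err P J xr t (x t) i ∧
        |PPC.err P J xr t (x t) i| < PPC.rho P.T₁ P.c t)) := by
  obtain ⟨D, hd⟩ := hd_bdd
  refine ⟨PPC.exists_global_solution hxr hd_meas hd x₀, fun b _ x _ hx => ?_⟩
  have hmod : ∀ i, ∀ t ∈ Set.Ioc 0 b, |PPC.modErr P J xr t (x t) i| < PPC.rho P.T₁ P.c t :=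
    fun i t ht => PPC.abs_lt_rho P.T₁_pos P.c_pos ht.1
      (PPC.insideAt_of_solvesOn hxr hd hx t ⟨ht.1.le, ht.2⟩ i)
  have heq : ∀ t i, PPC.factor P.T J t = 1 →
      PPC.modErr P J xr t (x t) i = PPC.err P J xr t (x t) i := fun t i h => by
    rw [PPC.modErr, h, one_mul]
  refine ⟨hmod, fun hJ i t ht => ?_, fun i t ht hfirst => ?_, fun τ hτ i t ht hnext => ?_⟩
  · rw [← heq t i (PPC.factor_of_forall_le (by simp [hJ]))]
    exact hmod i t ht
  · rw [← heq t i (PPC.factor_of_forall_le hfirst)]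
    exact hmod i t ht
  · have h1 := heq t i (PPC.factor_of_add_le P.T_pos hτ ht.1 hnext)
    refine ⟨h1, h1 ▸ hmod i t ⟨?_, ht.2⟩⟩
    linarith [hxr.pos τ hτ, P.T_pos, ht.1]
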